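/- Let $n\in\mathbb N$ and $p\in\mathbb R$ satisfy $1<p<n$ and $\frac{2n}{n+2}\le p\le 2$, and put $q=\frac{np}{n-p}$ and $\ell^*_p=\frac{n-p}{p-1}$. Let $\mathcal K:[0,+\infty[\,\to\,]0,+\infty[$ be of class $C^1$. Assume: $(\mathrm H_\ell)$ there are constants $A,B,\ell>0$ such that $\mathcal K(r)=A+Br^{\ell}+h(r)$ for $r\ge 0$, with $\displaystyle\lim_{r\to0^+}\frac{|h(r)|+r|h'(r)|}{r^{\ell}}=0$; $(\mathrm H_\uparrow)$ $\mathcal K$ is increasing (in the weak sense) on $[0,+\infty[$, and strictly increasing on some nondegenerate interval. For $\mathcal R>0$ consider the problem $$\begin{cases}\Delta_p u(x)+\mathcal K(|x|)\,u(x)|u(x)|^{q-2}=0, & |x|<\mathcal R,\\ u(x)>0, & |x|<\mathcal R,\\ u(x)=0, & |x|=\mathcal R,\end{cases}\qquad (P_{\mathcal R})$$ in $\mathbb R^n$, where $\Delta_p u=\operatorname{div}(|\nabla u|^{p-2}\nabla u)$. A radial solution is a function $u$ on the closed ball $\{|x|\le\mathcal R\}$ which depends only on $|x|$, is continuous on the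 closed ball and $C^1$ in the open ball, whose field $|\nabla u|^{p-2}\nabla u$ (read as $0$ where $\nabla u=0$) is differentiable in the open ball, and which satisfies $(P_{\mathcal R})$ pointwise. If $\ell=\ell^*_p$, then there is $\mathcal R_0>0$ such that $(P_{\mathcal R})$ has no radial solution when $0<\mathcal R<\mathcal R_0$, and at least one radial solution when $\mathcal R>\mathcal R_0$. If $\ell>\ell^*_p$, then there is $\mathcal R_0>0$ such that $(P_{\mathcal R})$ has no radial solution when $0<\mathcal R<\mathcal R_0$, at least one radial solution when $\mathcal R=\mathcal R_0$, and at least two distinct radial solutions when $\mathcal R>\mathcal R_0$. -/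

import Mathlib

open Set Filter Topology

noncomputable section

/-- The divergence `∑ᵢ ∂ᵢ Fᵢ` of a vector field on `ℝⁿ`. -/
def divergence {n : ℕ} (F : EuclideanSpace ℝ (Fin n) → EuclideanSpace ℝ (Fin n))
    (x : EuclideanSpace ℝ (Fin n)) : ℝ :=
  ∑ i : Fin n, (fderiv ℝ F x (EuclideanSpace.single i 1)) i

/-- The vector field `|∇u|^{p-2} ∇u`; for `p > 1` it vanishes where `∇u = 0`. -/
def pFlux {n : ℕ} (p : ℝ) (u : EuclideanSpace ℝ (Fin n) → ℝ)
    (x : EuclideanSpace ℝ (Fin n)) : EuclideanSpace ℝ (Fin n) :=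
  ‖gradient u x‖ ^ (p - 2) • gradient u x

/-- The `p`-Laplacian `div (|∇u|^{p-2} ∇u)`. -/
def pLaplacian {n : ℕ} (p : ℝ) (u : EuclideanSpace ℝ (Fin n) → ℝ)
    (x : EuclideanSpace ℝ (Fin n)) : ℝ :=
  divergence (pFlux p u) x

/-- The Sobolev critical exponent `n p / (n - p)`. -/
def sobolevExponent (n : ℕ) (p : ℝ) : ℝ := n * p / (n - p)

/-- The critical order of flatness `(n - p) / (p - 1)`. -/
def criticalFlatness (n : ℕ) (p : ℝ) : ℝ := (n - p) / (p - 1)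

/-- `u` is a radial solution of `Δ_p u + K(|x|) u |u|^{q-2} = 0` in the ball `|x| < R` of `ℝⁿ`,
with `u > 0` for `|x| < R` and `u = 0` for `|x| = R`, where `q` is the critical exponent.
Only the values of `u` on the closed ball matter. -/
structure IsRadialSolution (n : ℕ) (p : ℝ) (K : ℝ → ℝ) (R : ℝ)
    (u : EuclideanSpace ℝ (Fin n) → ℝ) : Prop where
  radial : ∀ x ∈ Metric.closedBall (0 : EuclideanSpace ℝ (Fin n)) R,
    ∀ y ∈ Metric.closedBall (0 : EuclideanSpace ℝ (Fin n)) R, ‖x‖ = ‖y‖ → u x = u y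
  continuousOn : ContinuousOn u (Metric.closedBall 0 R)
  contDiffOn : ContDiffOn ℝ 1 u (Metric.ball 0 R)
  differentiableOn_flux : DifferentiableOn ℝ (pFlux p u) (Metric.ball 0 R)
  equation : ∀ x ∈ Metric.ball (0 : EuclideanSpace ℝ (Fin n)) R,
    pLaplacian p u x + K ‖x‖ * (u x * |u x| ^ (sobolevExponent n p - 2)) = 0
  pos : ∀ x ∈ Metric.ball (0 : EuclideanSpace ℝ (Fin n)) R, 0 < u x
  boundary : ∀ x ∈ Metric.sphere (0 : EuclideanSpace ℝ (Fin n)) R, u x = 0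

/-- There are constants `A, B, ℓ > 0` (here `ℓ` is given) and a function `h` such that
`K(r) = A + B r^ℓ + h(r)` and `(|h(r)| + r |h'(r)|) / r^ℓ → 0` as `r → 0⁺`. -/
def FlatnessCondition (K : ℝ → ℝ) (l : ℝ) : Prop :=
  0 < l ∧ ∃ A B : ℝ, 0 < A ∧ 0 < B ∧ ∃ h : ℝ → ℝ,
    (∀ r, 0 ≤ r → K r = A + B * r ^ l + h r) ∧
    Tendsto (fun r => (|h r| + r * |deriv h r|) / r ^ l) (𝓝[>] 0) (𝓝 0)

/-- `K` is increasing on `[0, ∞)`, strictly on some nondegenerate interval. -/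
def IncreasingCondition (K : ℝ → ℝ) : Prop :=
  MonotoneOn K (Ici 0) ∧ ∃ a b : ℝ, 0 ≤ a ∧ a < b ∧ StrictMonoOn K (Icc a b)

end

/-!
A radial solution is determined by its value at the origin, so it is a shot of a singular initial
value problem restricted to the ball up to its first zero. Shots depend continuously on the initial
value, and the Pohozaev functional, whose derivative carries the sign of `K'`, shows that every shot
reaches a zero `σ(t)`, where `exp t` is the initial value. Hence `(P_R)` is solvable exactly
for `R` in the range of the continuous function `σ`.

Since a shot stays close to a small initial value for a long time, `σ(t) → ∞` as `t → -∞`. For large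
initial values, the Pohozaev identity at the first zero balances a boundary term, which is bounded
below by a power of the initial value, against the integral of `K'`, which flatness of order `l`
bounds above by another power. The two powers agree if `l = (n - p) / (p - 1)`, and then `σ`
stays away from `0`; for larger `l` they force `σ(t) → ∞` as `t → ∞`. The intermediate value theorem
then yields one solution above the infimum of `σ`, respectively two above its minimum.
-/

noncomputable section

/-! ### Weighted averages over balls -/

/-- The average `r⁻ⁿ ∫₀ʳ tⁿ⁻¹ f(t) dt`, rescaled to `[0, 1]` so that it makes sense at `r = 0`. -/
def ballAvg (n : ℕ) (f : ℝ → ℝ) (r : ℝ) : ℝ := ∫ t in (0 : ℝ)..1, t ^ (n - 1) * f (t * r)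

section BallAvg

variable {n : ℕ} {f g : ℝ → ℝ} {r C : ℝ}

lemma continuous_ballAvg (hf : Continuous f) : Continuous (ballAvg n f) := by
  unfold ballAvg
  apply intervalIntegral.continuous_parametric_intervalIntegral_of_continuous'
  fun_prop

lemma ballAvg_zero_right (hn : 0 < n) (f : ℝ → ℝ) : ballAvg n f 0 = f 0 / n := by
  obtain ⟨k, rfl⟩ : ∃ k, n = k + 1 := ⟨n - 1, by omega⟩
  simp [ballAvg, integral_pow, inv_mul_eq_div]

lemma pow_mul_ballAvg (hn : 0 < n) (f : ℝ → ℝ) (r : ℝ) :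
    r ^ n * ballAvg n f r = ∫ t in (0 : ℝ)..r, t ^ (n - 1) * f t := by
  obtain ⟨k, rfl⟩ : ∃ k, n = k + 1 := ⟨n - 1, by omega⟩
  have hscale : r * ∫ x in (0 : ℝ)..1, (x * r) ^ k * f (x * r) =
      ∫ t in (0 : ℝ)..r, t ^ k * f t := by
    simpa using intervalIntegral.smul_integral_comp_mul_right
      (a := 0) (b := 1) (fun t => t ^ k * f t) r
  simp only [ballAvg, Nat.add_sub_cancel]
  rw [← hscale, ← intervalIntegral.integral_const_mul, ← intervalIntegral.integral_const_mul]
  congr 1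
  ext t
  ring

lemma hasDerivAt_pow_mul_ballAvg (hn : 0 < n) (hf : Continuous f) (r : ℝ) :
    HasDerivAt (fun r => r ^ n * ballAvg n f r) (r ^ (n - 1) * f r) r := by
  simp only [pow_mul_ballAvg hn]
  exact (Continuous.integral_hasStrictDerivAt (by fun_prop) 0 r).hasDerivAt

lemma hasDerivAt_ballAvg (hn : 0 < n) (hf : Continuous f) (hr : r ≠ 0) :
    HasDerivAt (ballAvg n f) ((f r - n * ballAvg n f r) / r) r := by
  have hquot := (hasDerivAt_pow_mul_ballAvg hn hf r).div (hasDerivAt_pow n r) (pow_ne_zero n hr)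
  have heq : ballAvg n f =ᶠ[𝓝 r] (fun r => r ^ n * ballAvg n f r) / fun x => x ^ n := by
    filter_upwards [isOpen_ne.mem_nhds hr] with x hx
    simp [mul_div_cancel_left₀ _ (pow_ne_zero n hx)]
  refine (hquot.congr_of_eventuallyEq heq).congr_deriv ?_
  obtain ⟨k, rfl⟩ : ∃ k, n = k + 1 := ⟨n - 1, by omega⟩
  simp only [Nat.add_sub_cancel]
  field_simp
  ring

lemma mul_mem_Icc_of_mem_Icc {t : ℝ} (ht : t ∈ Icc (0 : ℝ) 1) (hr : 0 ≤ r) : t * r ∈ Icc 0 r :=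
  ⟨mul_nonneg ht.1 hr, mul_le_of_le_one_left hr ht.2⟩

lemma ballAvg_nonneg (hr : 0 ≤ r) (hf : ∀ t ∈ Icc 0 r, 0 ≤ f t) : 0 ≤ ballAvg n f r :=
  intervalIntegral.integral_nonneg zero_le_one fun _ ht =>
    mul_nonneg (pow_nonneg ht.1 _) (hf _ (mul_mem_Icc_of_mem_Icc ht hr))

lemma ballAvg_congr (hr : 0 ≤ r) (h : EqOn f g (Icc 0 r)) : ballAvg n f r = ballAvg n g r := by
  refine intervalIntegral.integral_congr fun t ht => ?_
  rw [uIcc_of_le zero_le_one] at ht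
  simp only [h (mul_mem_Icc_of_mem_Icc ht hr)]

lemma abs_ballAvg_le (hr : 0 ≤ r) (h : ∀ t ∈ Icc 0 r, |f t| ≤ C) : |ballAvg n f r| ≤ C := by
  have hbound : ∀ t ∈ uIoc (0 : ℝ) 1, ‖t ^ (n - 1) * f (t * r)‖ ≤ C := by
    intro t ht
    rw [uIoc_of_le zero_le_one] at ht
    have hf := h _ (mul_mem_Icc_of_mem_Icc ⟨ht.1.le, ht.2⟩ hr)
    rw [norm_mul, norm_pow, Real.norm_eq_abs, abs_of_pos ht.1]
    exact (mul_le_of_le_one_left (abs_nonneg _) (pow_le_one₀ ht.1.le ht.2)).trans hf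
  simpa [ballAvg] using intervalIntegral.norm_integral_le_of_norm_le_const hbound

lemma abs_ballAvg_sub_le (hf : Continuous f) (hg : Continuous g) (hr : 0 ≤ r)
    (h : ∀ t ∈ Icc 0 r, |f t - g t| ≤ C) : |ballAvg n f r - ballAvg n g r| ≤ C := by
  have hsub : ballAvg n f r - ballAvg n g r = ballAvg n (fun t => f t - g t) r := by
    simp only [ballAvg, mul_sub]
    refine (intervalIntegral.integral_sub ?_ ?_).symm <;>
      exact Continuous.intervalIntegrable (by fun_prop) _ _
  rw [hsub]
  exact abs_ballAvg_le hr h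

end BallAvg

/-! ### Volterra equations -/

section Volterra

variable {E : Type*} [NormedAddCommGroup E]

/-- `F` maps continuous functions to continuous functions, and on `[0, T]` it is Lipschitz with
constant `L` in the causal sense: `F u x` only feels the values of `u` on `[0, x]`. -/
structure IsCausalLipschitz (F : (ℝ → E) → ℝ → E) (L T : ℝ) : Prop where
  continuous : ∀ {u : ℝ → E}, Continuous u → Continuous (F u)
  norm_sub_le : ∀ {u v : ℝ → E}, Continuous u → Continuous v → ∀ {x C : ℝ}, x ∈ Icc 0 T →
    (∀ t ∈ Icc 0 x, ‖u t - v t‖ ≤ C) → ‖F u x - F v x‖ ≤ L * C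

lemma IsCausalLipschitz.eq_of_eqOn {F : (ℝ → E) → ℝ → E} {L T : ℝ}
    (hF : IsCausalLipschitz F L T) {u v : ℝ → E} (hu : Continuous u) (hv : Continuous v) {x : ℝ}
    (hx : x ∈ Icc 0 T) (h : EqOn u v (Icc 0 x)) : F u x = F v x := by
  have hsub := hF.norm_sub_le hu hv hx (C := 0) fun t ht => by simp [h ht]
  rw [mul_zero] at hsub
  exact sub_eq_zero.1 (norm_le_zero_iff.1 hsub)

variable [NormedSpace ℝ E]

lemma norm_integral_sub_le_of_norm_sub_le_exp {f g : ℝ → E} (hf : Continuous f)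
    (hg : Continuous g) {C l r : ℝ} (hC : 0 ≤ C) (hl : 0 < l) (hr : 0 ≤ r)
    (h : ∀ x ∈ Icc 0 r, ‖f x - g x‖ ≤ C * Real.exp (l * x)) :
    ‖(∫ x in (0 : ℝ)..r, f x) - ∫ x in (0 : ℝ)..r, g x‖ ≤ C / l * Real.exp (l * r) := by
  rw [← intervalIntegral.integral_sub (hf.intervalIntegrable _ _) (hg.intervalIntegrable _ _)]
  calc ‖∫ x in (0 : ℝ)..r, (f x - g x)‖
      ≤ ∫ x in (0 : ℝ)..r, C * Real.exp (l * x) :=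
        intervalIntegral.norm_integral_le_of_norm_le hr
          (Eventually.of_forall fun x hx => h x ⟨hx.1.le, hx.2⟩)
          (Continuous.intervalIntegrable (by fun_prop) _ _)
    _ = C / l * (Real.exp (l * r) - 1) := by
        rw [intervalIntegral.integral_const_mul,
          intervalIntegral.integral_comp_mul_left (fun x => Real.exp x) hl.ne', integral_exp]
        simp only [mul_zero, Real.exp_zero, smul_eq_mul]
        ring
    _ ≤ C / l * Real.exp (l * r) :=
        mul_le_mul_of_nonneg_left (by linarith) (by positivity)

/-- The function on `ℝ` represented by `y` when `C([0, T], E)` carries the weight `exp (-2Lt)`. -/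
def expUnweight (L : ℝ) {T : ℝ} (hT : 0 ≤ T) (y : C(Icc (0 : ℝ) T, E)) (t : ℝ) : E :=
  Real.exp (2 * L * t) • IccExtend hT y t

/-- The representative in the weighted space `C([0, T], E)` of a continuous function on `ℝ`. -/
def expWeight (L T : ℝ) {u : ℝ → E} (hu : Continuous u) : C(Icc (0 : ℝ) T, E) where
  toFun t := Real.exp (-(2 * L * t)) • u t

lemma continuous_expUnweight {L T : ℝ} {hT : 0 ≤ T} (y : C(Icc (0 : ℝ) T, E)) :
    Continuous (expUnweight L hT y) :=
  (by fun_prop : Continuous fun t : ℝ => Real.exp (2 * L * t)).smul y.continuous.Icc_extend'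

lemma exp_smul_exp_neg_smul (s : ℝ) (e : E) : Real.exp s • Real.exp (-s) • e = e := by
  rw [smul_smul, ← Real.exp_add, add_neg_cancel, Real.exp_zero, one_smul]

lemma expUnweight_expWeight {L T : ℝ} {hT : 0 ≤ T} {u : ℝ → E} (hu : Continuous u) :
    EqOn (expUnweight L hT (expWeight L T hu)) u (Icc 0 T) := fun t ht => by
  simp [expUnweight, expWeight, IccExtend_of_mem hT _ ht, exp_smul_exp_neg_smul]

lemma norm_expUnweight_sub_le {L T : ℝ} (hL : 0 ≤ L) {hT : 0 ≤ T} (y z : C(Icc (0 : ℝ) T, E))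
    {t x : ℝ} (htx : t ≤ x) :
    ‖expUnweight L hT y t - expUnweight L hT z t‖ ≤ dist y z * Real.exp (2 * L * x) := by
  have hdist : ‖IccExtend hT y t - IccExtend hT z t‖ ≤ dist y z := by
    rw [← dist_eq_norm]
    exact ContinuousMap.dist_apply_le_dist (f := y) (g := z) (projIcc 0 T hT t)
  rw [expUnweight, expUnweight, ← smul_sub, norm_smul, Real.norm_of_nonneg (Real.exp_pos _).le,
    mul_comm]
  gcongr

namespace IsCausalLipschitz

variable {F : (ℝ → E) → ℝ → E} {L T : ℝ}

/-- The Picard operator `u ↦ a + ∫₀ʳ F u`, conjugated by the weight `exp (-2Lt)`, which makes it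
contracting on all of `[0, T]`. -/
def picard (hF : IsCausalLipschitz F L T) (hT : 0 ≤ T) (a : E) (y : C(Icc (0 : ℝ) T, E)) :
    C(Icc (0 : ℝ) T, E) :=
  expWeight L T (u := fun r => a + ∫ x in (0 : ℝ)..r, F (expUnweight L hT y) x)
    (continuous_const.add (intervalIntegral.continuous_primitive
      (fun _ _ => (hF.continuous (continuous_expUnweight y)).intervalIntegrable _ _) 0))

lemma dist_picard_le (hF : IsCausalLipschitz F L T) (hT : 0 ≤ T) (hL : 0 < L) (a b : E)
    (y z : C(Icc (0 : ℝ) T, E)) :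
    dist (hF.picard hT a y) (hF.picard hT b z) ≤ dist a b + dist y z / 2 := by
  rw [ContinuousMap.dist_le (by positivity)]
  intro r
  set I : C(Icc (0 : ℝ) T, E) → E := fun y => ∫ x in (0 : ℝ)..r, F (expUnweight L hT y) x
  have hI : ‖I y - I z‖ ≤ L * dist y z / (2 * L) * Real.exp (2 * L * r) := by
    refine norm_integral_sub_le_of_norm_sub_le_exp (hF.continuous (continuous_expUnweight y))
      (hF.continuous (continuous_expUnweight z)) (by positivity) (by positivity) r.2.1
      fun x hx => ?_
    rw [mul_assoc]
    exact hF.norm_sub_le (continuous_expUnweight y) (continuous_expUnweight z)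
      ⟨hx.1, hx.2.trans r.2.2⟩ fun t ht => norm_expUnweight_sub_le hL.le y z ht.2
  have hle : Real.exp (-(2 * L * r)) ≤ 1 := by
    have := r.2.1
    exact Real.exp_le_one_iff.2 (neg_nonpos.2 (by positivity))
  calc dist (hF.picard hT a y r) (hF.picard hT b z r)
      = Real.exp (-(2 * L * r)) * ‖(a - b) + (I y - I z)‖ := by
        simp only [picard, expWeight, ContinuousMap.coe_mk, dist_eq_norm, ← smul_sub, norm_smul,
          Real.norm_of_nonneg (Real.exp_pos _).le, add_sub_add_comm, I]
    _ ≤ Real.exp (-(2 * L * r)) * (dist a b + L * dist y z / (2 * L) * Real.exp (2 * L * r)) := by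
        rw [dist_eq_norm]
        gcongr
        exact (norm_add_le _ _).trans (by gcongr)
    _ = Real.exp (-(2 * L * r)) * dist a b + dist y z / 2 := by
        rw [Real.exp_neg]
        field_simp
    _ ≤ dist a b + dist y z / 2 := by
        gcongr
        exact mul_le_of_le_one_left dist_nonneg hle

lemma picard_expWeight (hF : IsCausalLipschitz F L T) (hT : 0 ≤ T) {a : E} {u : ℝ → E}
    (hu : Continuous u) (h : ∀ r ∈ Icc 0 T, u r = a + ∫ x in (0 : ℝ)..r, F u x) :
    hF.picard hT a (expWeight L T hu) = expWeight L T hu := by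
  ext r
  simp only [picard, expWeight, ContinuousMap.coe_mk]
  rw [h r r.2]
  congr 2
  refine intervalIntegral.integral_congr fun x hx => ?_
  rw [uIcc_of_le r.2.1] at hx
  have hxT : x ∈ Icc 0 T := ⟨hx.1, hx.2.trans r.2.2⟩
  exact hF.eq_of_eqOn (continuous_expUnweight _) hu hxT
    ((expUnweight_expWeight hu).mono (Icc_subset_Icc_right hxT.2))

lemma norm_sub_le_of_volterra (hF : IsCausalLipschitz F L T) (hL : 0 < L) {a b : E} {u v : ℝ → E}
    (hu : Continuous u) (hv : Continuous v)
    (hua : ∀ r ∈ Icc 0 T, u r = a + ∫ x in (0 : ℝ)..r, F u x)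
    (hvb : ∀ r ∈ Icc 0 T, v r = b + ∫ x in (0 : ℝ)..r, F v x) {r : ℝ} (hr : r ∈ Icc 0 T) :
    ‖u r - v r‖ ≤ 2 * Real.exp (2 * L * T) * ‖a - b‖ := by
  have hT : 0 ≤ T := hr.1.trans hr.2
  have hfix := hF.dist_picard_le hT hL a b (expWeight L T hu) (expWeight L T hv)
  rw [hF.picard_expWeight hT hu hua, hF.picard_expWeight hT hv hvb, dist_eq_norm a] at hfix
  rw [← expUnweight_expWeight hu (L := L) (hT := hT) hr,
    ← expUnweight_expWeight hv (L := L) (hT := hT) hr]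
  calc _ ≤ dist (expWeight L T hu) (expWeight L T hv) * Real.exp (2 * L * T) :=
        norm_expUnweight_sub_le hL.le _ _ hr.2
    _ ≤ (2 * ‖a - b‖) * Real.exp (2 * L * T) := by gcongr; linarith
    _ = _ := by ring

variable [CompleteSpace E]

lemma exists_volterra_Icc (hF : IsCausalLipschitz F L T) (hT : 0 ≤ T) (hL : 0 < L) (a : E) :
    ∃ u : ℝ → E, Continuous u ∧ ∀ r ∈ Icc 0 T, u r = a + ∫ x in (0 : ℝ)..r, F u x := by
  have hcontr : ContractingWith (1 / 2) (hF.picard hT a) := by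
    refine ⟨by rw [← NNReal.coe_lt_coe]; norm_num, LipschitzWith.of_dist_le_mul fun y z => ?_⟩
    simpa [inv_mul_eq_div] using hF.dist_picard_le hT hL a a y z
  set y := ContractingWith.fixedPoint (hF.picard hT a) hcontr
  refine ⟨expUnweight L hT y, continuous_expUnweight y, fun r hr => ?_⟩
  have hy : expUnweight L hT (hF.picard hT a y) r = expUnweight L hT y r := by
    rw [hcontr.fixedPoint_isFixedPt]
  exact hy.symm.trans (expUnweight_expWeight _ hr)

lemma exists_volterra (hF : ∀ T, ∃ L, 0 < L ∧ IsCausalLipschitz F L T) (a : E) :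
    ∃ u : ℝ → E, Continuous u ∧ ∀ r, 0 ≤ r → u r = a + ∫ x in (0 : ℝ)..r, F u x := by
  have hex : ∀ T : ℝ, ∃ u : ℝ → E, Continuous u ∧
      ∀ r ∈ Icc 0 T, u r = a + ∫ x in (0 : ℝ)..r, F u x := fun T => by
    obtain ⟨L, hL, hFT⟩ := hF (max T 0)
    obtain ⟨u, hu, h⟩ := hFT.exists_volterra_Icc (le_max_right T 0) hL a
    exact ⟨u, hu, fun r hr => h r ⟨hr.1, hr.2.trans (le_max_left _ _)⟩⟩
  choose w hwc hw using hex
  have huniq : ∀ {T T' r}, 0 ≤ r → r ≤ T → r ≤ T' → w T r = w T' r := by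
    intro T T' r h0 hT hT'
    obtain ⟨L, hL, hFr⟩ := hF r
    have := hFr.norm_sub_le_of_volterra hL (hwc T) (hwc T')
      (fun x hx => hw T x ⟨hx.1, hx.2.trans hT⟩) (fun x hx => hw T' x ⟨hx.1, hx.2.trans hT'⟩)
      ⟨h0, le_rfl⟩
    rw [sub_self, norm_zero, mul_zero] at this
    exact sub_eq_zero.1 (norm_le_zero_iff.1 this)
  set u : ℝ → E := fun r => w (max r 0 + 1) (max r 0)
  have hu_eq : ∀ T r, 0 ≤ r → r ≤ T → u r = w T r := fun T r h0 hT => by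
    simp only [u, max_eq_left h0]
    exact huniq h0 (by linarith) hT
  have hu : Continuous u := continuous_iff_continuousAt.2 fun r₀ => by
    have hc : Continuous fun r => w (max r₀ 0 + 1) (max r 0) := by fun_prop
    refine hc.continuousAt.congr ?_
    filter_upwards [Iio_mem_nhds (show r₀ < max r₀ 0 + 1 by linarith [le_max_left r₀ 0])] with r hr
    exact huniq (le_max_right _ _) (max_le hr.le (by linarith [le_max_right r₀ 0])) (by linarith)
  refine ⟨u, hu, fun r hr => ?_⟩
  obtain ⟨L, -, hFr⟩ := hF r
  rw [hu_eq r r hr le_rfl, hw r r ⟨hr, le_rfl⟩]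
  congr 1
  refine intervalIntegral.integral_congr fun x hx => ?_
  rw [uIcc_of_le hr] at hx
  exact hFr.eq_of_eqOn (hwc r) hu hx fun t ht => (hu_eq r t ht.1 (ht.2.trans hx.2)).symm

end IsCausalLipschitz

end Volterra

/-! ### The shooting problem -/

/-- Standing assumptions for the shooting problem: `m = 1 / (p - 1)`, `q` is the critical exponent
and `γ = p / (n - p)`; the weight `K` is extended to all of `ℝ`. -/
structure ShootingData (n : ℕ) (m q γ : ℝ) (K : ℝ → ℝ) : Prop where
  n_pos : 0 < n
  one_le_m : 1 ≤ m
  two_le_q : 2 ≤ q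
  γ_pos : 0 < γ
  q_eq : q = n * γ
  q_mul : q * m = (1 + m) * (1 + γ)
  cont : Continuous K
  pos : ∀ r, 0 < K r
  mono : Monotone K
  diff : ∀ r, 0 < r → DifferentiableAt ℝ K r

/-- The right-hand side `K u₊^(q-1)` of the radial equation. -/
def radialSource (q : ℝ) (K u : ℝ → ℝ) (t : ℝ) : ℝ := K t * max (u t) 0 ^ (q - 1)

/-- The average `r⁻ⁿ ∫₀ʳ tⁿ⁻¹ K(t) u₊(t)^(q-1) dt`; along a radial solution
`|u'|^(p-2) u' = -r * fluxAvg r`. -/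
def fluxAvg (n : ℕ) (q : ℝ) (K u : ℝ → ℝ) : ℝ → ℝ := ballAvg n (radialSource q K u)

/-- The slope `-u'` prescribed by the radial equation. -/
def radialSlope (n : ℕ) (m q : ℝ) (K u : ℝ → ℝ) (r : ℝ) : ℝ := (r * fluxAvg n q K u r) ^ m

/-- `u` solves the radial initial value problem on `[0, ∞)` with `u 0 = a > 0`, in integrated form.
Since the nonlinearity is `u₊^(q-1)`, a shot goes on beyond its first zero. -/
structure IsShot (n : ℕ) (m q : ℝ) (K : ℝ → ℝ) (a : ℝ) (u : ℝ → ℝ) : Prop where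
  cont : Continuous u
  pos : 0 < a
  eq : ∀ r, 0 ≤ r → u r = a - ∫ x in (0 : ℝ)..r, radialSlope n m q K u x

lemma abs_rpow_sub_rpow_le {e B x y : ℝ} (he : 1 ≤ e) (hx : x ∈ Icc 0 B) (hy : y ∈ Icc 0 B) :
    |x ^ e - y ^ e| ≤ e * B ^ (e - 1) * |x - y| := by
  have hderiv : ∀ z ∈ Icc 0 B, ‖e * z ^ (e - 1)‖ ≤ e * B ^ (e - 1) := fun z hz => by
    have := Real.rpow_le_rpow hz.1 hz.2 (by linarith : 0 ≤ e - 1)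
    rw [norm_mul, Real.norm_of_nonneg (by linarith), Real.norm_of_nonneg (Real.rpow_nonneg hz.1 _)]
    gcongr
  exact (convex_Icc (0 : ℝ) B).norm_image_sub_le_of_norm_hasDerivWithin_le (f := fun x => x ^ e)
    (fun z _ => (Real.hasDerivAt_rpow_const (Or.inr he)).hasDerivWithinAt) hderiv hy hx

section Shot

variable {n : ℕ} {m q γ a : ℝ} {K u v : ℝ → ℝ}

namespace ShootingData

lemma continuous_radialSource (h : ShootingData n m q γ K) (hu : Continuous u) :
    Continuous (radialSource q K u) :=
  h.cont.mul ((hu.max continuous_const).rpow_const fun _ => Or.inr (by linarith [h.two_le_q]))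

lemma continuous_fluxAvg (h : ShootingData n m q γ K) (hu : Continuous u) :
    Continuous (fluxAvg n q K u) := continuous_ballAvg (h.continuous_radialSource hu)

lemma continuous_radialSlope (h : ShootingData n m q γ K) (hu : Continuous u) :
    Continuous (radialSlope n m q K u) :=
  (continuous_id.mul (h.continuous_fluxAvg hu)).rpow_const
    fun _ => Or.inr (by linarith [h.one_le_m])

lemma radialSource_nonneg (h : ShootingData n m q γ K) (u : ℝ → ℝ) (t : ℝ) :
    0 ≤ radialSource q K u t :=
  mul_nonneg (h.pos t).le (Real.rpow_nonneg (le_max_right _ _) _)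

lemma fluxAvg_nonneg (h : ShootingData n m q γ K) (u : ℝ → ℝ) {r : ℝ} (hr : 0 ≤ r) :
    0 ≤ fluxAvg n q K u r :=
  ballAvg_nonneg hr fun t _ => h.radialSource_nonneg u t

lemma radialSlope_nonneg (h : ShootingData n m q γ K) (u : ℝ → ℝ) {r : ℝ} (hr : 0 ≤ r) :
    0 ≤ radialSlope n m q K u r :=
  Real.rpow_nonneg (mul_nonneg hr (h.fluxAvg_nonneg u hr)) _

lemma fluxAvg_le (h : ShootingData n m q γ K) {Λ r : ℝ} (hΛ : 0 ≤ Λ) (hr : 0 ≤ r)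
    (hu : ∀ t ∈ Icc 0 r, u t ≤ Λ) : fluxAvg n q K u r ≤ K r * Λ ^ (q - 1) := by
  refine (le_abs_self _).trans (abs_ballAvg_le hr fun t ht => ?_)
  rw [abs_of_nonneg (h.radialSource_nonneg u t)]
  exact mul_le_mul (h.mono ht.2) (Real.rpow_le_rpow (le_max_right _ _)
    (max_le (hu t ht) hΛ) (by linarith [h.two_le_q]))
    (Real.rpow_nonneg (le_max_right _ _) _) (h.pos r).le

lemma mul_fluxAvg_mem_Icc (h : ShootingData n m q γ K) {Λ T x : ℝ} (hΛ : 0 ≤ Λ)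
    (hx : x ∈ Icc 0 T) (hu : ∀ t ∈ Icc 0 x, u t ≤ Λ) :
    x * fluxAvg n q K u x ∈ Icc 0 (T * (K T * Λ ^ (q - 1))) := by
  have hflux := h.fluxAvg_nonneg u hx.1
  refine ⟨mul_nonneg hx.1 hflux, mul_le_mul hx.2 ?_ hflux (hx.1.trans hx.2)⟩
  exact (h.fluxAvg_le hΛ hx.1 hu).trans
    (mul_le_mul_of_nonneg_right (h.mono hx.2) (Real.rpow_nonneg hΛ _))

lemma abs_radialSource_sub_le (h : ShootingData n m q γ K) {Λ T t : ℝ} (hΛ : 0 ≤ Λ) (ht : t ≤ T)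
    (hu : u t ≤ Λ) (hv : v t ≤ Λ) :
    |radialSource q K u t - radialSource q K v t|
      ≤ K T * ((q - 1) * Λ ^ (q - 1 - 1) * |u t - v t|) := by
  have hq : 1 ≤ q - 1 := by linarith [h.two_le_q]
  rw [radialSource, radialSource, ← mul_sub, abs_mul, abs_of_pos (h.pos t)]
  refine mul_le_mul (h.mono ht) ?_ (abs_nonneg _) (h.pos T).le
  refine (abs_rpow_sub_rpow_le hq ⟨le_max_right _ _, max_le hu hΛ⟩
    ⟨le_max_right _ _, max_le hv hΛ⟩).trans ?_
  exact mul_le_mul_of_nonneg_left (abs_max_sub_max_le_abs _ _ _)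
    (mul_nonneg (by linarith) (Real.rpow_nonneg hΛ _))

lemma abs_radialSlope_sub_le (h : ShootingData n m q γ K) {Λ T C x : ℝ} (hΛ : 0 ≤ Λ)
    (hu : Continuous u) (hv : Continuous v) (hx : x ∈ Icc 0 T) (huΛ : ∀ t ∈ Icc 0 x, u t ≤ Λ)
    (hvΛ : ∀ t ∈ Icc 0 x, v t ≤ Λ) (hC : ∀ t ∈ Icc 0 x, |u t - v t| ≤ C) :
    |radialSlope n m q K u x - radialSlope n m q K v x|
      ≤ m * (T * (K T * Λ ^ (q - 1))) ^ (m - 1)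
        * (T * (K T * ((q - 1) * Λ ^ (q - 1 - 1) * C))) := by
  have hT : 0 ≤ T := hx.1.trans hx.2
  have hq : 0 ≤ q - 1 := by linarith [h.two_le_q]
  have hflux : |fluxAvg n q K u x - fluxAvg n q K v x|
      ≤ K T * ((q - 1) * Λ ^ (q - 1 - 1) * C) := by
    refine abs_ballAvg_sub_le (h.continuous_radialSource hu) (h.continuous_radialSource hv) hx.1
      fun t ht => (h.abs_radialSource_sub_le hΛ (ht.2.trans hx.2) (huΛ t ht) (hvΛ t ht)).trans ?_
    have := hC t ht
    have := (h.pos T).le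
    gcongr
  refine (abs_rpow_sub_rpow_le h.one_le_m (h.mul_fluxAvg_mem_Icc hΛ hx huΛ)
    (h.mul_fluxAvg_mem_Icc hΛ hx hvΛ)).trans ?_
  rw [← mul_sub, abs_mul, abs_of_nonneg hx.1]
  refine mul_le_mul_of_nonneg_left (mul_le_mul hx.2 hflux (abs_nonneg _) hT)
    (mul_nonneg (by linarith [h.one_le_m]) (Real.rpow_nonneg ?_ _))
  exact mul_nonneg hT (mul_nonneg (h.pos T).le (Real.rpow_nonneg hΛ _))

lemma exists_isCausalLipschitz_radialSlope_min (h : ShootingData n m q γ K) {Λ : ℝ} (hΛ : 0 ≤ Λ)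
    (T : ℝ) : ∃ L, 0 < L ∧
      IsCausalLipschitz (fun u x => -radialSlope n m q K (fun t => min (u t) Λ) x) L T := by
  set L := m * (T * (K T * Λ ^ (q - 1))) ^ (m - 1) * (T * (K T * ((q - 1) * Λ ^ (q - 1 - 1))))
  refine ⟨|L| + 1, by positivity, ⟨fun hu => ?_, @fun u v hu hv x C hx hC => ?_⟩⟩
  · exact (h.continuous_radialSlope (hu.min continuous_const)).neg
  · have hC0 : 0 ≤ C := (norm_nonneg _).trans (hC 0 ⟨le_rfl, hx.1⟩)
    have hmin : ∀ t ∈ Icc 0 x, |min (u t) Λ - min (v t) Λ| ≤ C := fun t ht =>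
      (abs_min_sub_min_le_max _ _ _ _).trans (max_le (hC t ht) (by simpa using hC0))
    have hslope := h.abs_radialSlope_sub_le hΛ (hu.min continuous_const)
      (hv.min continuous_const) hx (fun _ _ => min_le_right _ _) (fun _ _ => min_le_right _ _) hmin
    rw [← norm_neg]
    simp only [neg_sub_neg, neg_sub, Real.norm_eq_abs]
    calc _ ≤ L * C := hslope.trans_eq (by ring)
      _ ≤ (|L| + 1) * C := by gcongr; linarith [le_abs_self L]

end ShootingData

lemma radialSlope_congr {r : ℝ} (hr : 0 ≤ r) (huv : EqOn u v (Icc 0 r)) :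
    radialSlope n m q K u r = radialSlope n m q K v r := by
  have hsource : EqOn (radialSource q K u) (radialSource q K v) (Icc 0 r) := fun t ht => by
    rw [radialSource, radialSource, huv ht]
  rw [radialSlope, radialSlope, fluxAvg, fluxAvg, ballAvg_congr hr hsource]

lemma integral_radialSlope_congr {r : ℝ} (hr : 0 ≤ r) (huv : EqOn u v (Icc 0 r)) :
    ∫ x in (0 : ℝ)..r, radialSlope n m q K u x = ∫ x in (0 : ℝ)..r, radialSlope n m q K v x := by
  refine intervalIntegral.integral_congr fun x hx => ?_
  rw [uIcc_of_le hr] at hx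
  exact radialSlope_congr hx.1 (huv.mono (Icc_subset_Icc_right hx.2))

namespace ShootingData

lemma sub_integral_radialSlope_le (h : ShootingData n m q γ K) (a : ℝ) (u : ℝ → ℝ) {r : ℝ}
    (hr : 0 ≤ r) : a - ∫ x in (0 : ℝ)..r, radialSlope n m q K u x ≤ a :=
  sub_le_self a (intervalIntegral.integral_nonneg hr fun _ hx => h.radialSlope_nonneg u hx.1)

-- The truncation at height `a` never acts, because solutions decrease from `a`.
lemma exists_isShot (h : ShootingData n m q γ K) (ha : 0 < a) : ∃ u, IsShot n m q K a u := by
  obtain ⟨u, hc, hu⟩ := IsCausalLipschitz.exists_volterra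
    (h.exists_isCausalLipschitz_radialSlope_min ha.le) a
  simp only [intervalIntegral.integral_neg, ← sub_eq_add_neg] at hu
  have hmin : ∀ r, 0 ≤ r → min (u r) a = u r := fun r hr =>
    min_eq_left ((hu r hr).trans_le (h.sub_integral_radialSlope_le a _ hr))
  refine ⟨u, hc, ha, fun r hr => (hu r hr).trans ?_⟩
  rw [integral_radialSlope_congr hr fun t ht => hmin t ht.1]

lemma exists_abs_sub_le_mul (h : ShootingData n m q γ K) {Λ : ℝ} (hΛ : 0 ≤ Λ) (T : ℝ) :
    ∃ L : ℝ, ∀ (a₁ a₂ : ℝ) (u₁ u₂ : ℝ → ℝ), a₁ ≤ Λ → a₂ ≤ Λ →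
      Continuous u₁ → Continuous u₂ →
      (∀ r ∈ Icc 0 T, u₁ r = a₁ - ∫ x in (0 : ℝ)..r, radialSlope n m q K u₁ x) →
      (∀ r ∈ Icc 0 T, u₂ r = a₂ - ∫ x in (0 : ℝ)..r, radialSlope n m q K u₂ x) →
      ∀ r ∈ Icc 0 T, |u₁ r - u₂ r| ≤ L * |a₁ - a₂| := by
  obtain ⟨L, hL, hF⟩ := h.exists_isCausalLipschitz_radialSlope_min hΛ T
  have hvolterra : ∀ (a : ℝ) (u : ℝ → ℝ), a ≤ Λ →
      (∀ r ∈ Icc 0 T, u r = a - ∫ x in (0 : ℝ)..r, radialSlope n m q K u x) → ∀ r ∈ Icc 0 T,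
      u r = a + ∫ x in (0 : ℝ)..r, -radialSlope n m q K (fun t => min (u t) Λ) x := by
    intro a u ha hu r hr
    rw [intervalIntegral.integral_neg, ← sub_eq_add_neg, hu r hr]
    congr 1
    refine integral_radialSlope_congr hr.1 fun t ht => (min_eq_left ?_).symm
    rw [hu t ⟨ht.1, ht.2.trans hr.2⟩]
    exact (h.sub_integral_radialSlope_le a u ht.1).trans ha
  exact ⟨2 * Real.exp (2 * L * T), fun a₁ a₂ u₁ u₂ h₁ h₂ hc₁ hc₂ hu₁ hu₂ r hr =>
    hF.norm_sub_le_of_volterra hL hc₁ hc₂ (hvolterra a₁ u₁ h₁ hu₁) (hvolterra a₂ u₂ h₂ hu₂) hr⟩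

end ShootingData

namespace IsShot

lemma apply_zero (hu : IsShot n m q K a u) : u 0 = a := by simpa using hu.eq 0 le_rfl

lemma le_init (hu : IsShot n m q K a u) (h : ShootingData n m q γ K) {r : ℝ} (hr : 0 ≤ r) :
    u r ≤ a := (hu.eq r hr).trans_le (h.sub_integral_radialSlope_le a u hr)

lemma hasDerivAt (hu : IsShot n m q K a u) (h : ShootingData n m q γ K) {r : ℝ} (hr : 0 < r) :
    HasDerivAt u (-radialSlope n m q K u r) r := by
  refine (((h.continuous_radialSlope hu.cont).integral_hasStrictDerivAt 0 r).hasDerivAt.const_sub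
    a).congr_of_eventuallyEq ?_
  filter_upwards [Ioi_mem_nhds hr] with x hx using hu.eq x (le_of_lt hx)

lemma hasDerivAt_fluxAvg (hu : IsShot n m q K a u) (h : ShootingData n m q γ K) {r : ℝ}
    (hr : 0 < r) : HasDerivAt (fluxAvg n q K u)
      ((radialSource q K u r - n * fluxAvg n q K u r) / r) r :=
  hasDerivAt_ballAvg h.n_pos (h.continuous_radialSource hu.cont) hr.ne'

lemma fluxAvg_zero (hu : IsShot n m q K a u) (h : ShootingData n m q γ K) :
    fluxAvg n q K u 0 = K 0 * a ^ (q - 1) / n := by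
  rw [fluxAvg, ballAvg_zero_right h.n_pos, radialSource, hu.apply_zero, max_eq_left hu.pos.le]

lemma init_sub_le (hu : IsShot n m q K a u) (h : ShootingData n m q γ K) {r : ℝ} (hr : 0 ≤ r) :
    a - r * (r * (K r * a ^ (q - 1))) ^ m ≤ u r := by
  have hslope : ∀ x ∈ Icc 0 r, radialSlope n m q K u x ≤ (r * (K r * a ^ (q - 1))) ^ m := by
    intro x hx
    have hmem := h.mul_fluxAvg_mem_Icc hu.pos.le hx fun t ht => hu.le_init h ht.1
    exact Real.rpow_le_rpow hmem.1 hmem.2 (by linarith [h.one_le_m])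
  have hint := intervalIntegral.integral_mono_on (μ := MeasureTheory.volume) hr
    ((h.continuous_radialSlope hu.cont).intervalIntegrable _ _)
    (continuous_const.intervalIntegrable _ _) hslope
  rw [intervalIntegral.integral_const, smul_eq_mul, sub_zero] at hint
  rw [hu.eq r hr]
  linarith

end IsShot

end Shot

/-! ### The Pohozaev functional -/

lemma mul_rpow_sub_one_eq {x : ℝ} (hx : 0 < x) (e : ℝ) : x * x ^ (e - 1) = x ^ e := by
  rw [Real.rpow_sub_one hx.ne', mul_div_cancel₀ _ hx.ne']

lemma rpow_neg_mul_rpow {x : ℝ} (hx : 0 < x) (e : ℝ) : x ^ (-e) * x ^ e = 1 := by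
  rw [← Real.rpow_add hx, neg_add_cancel, Real.rpow_zero]

lemma sub_le_of_hasDerivAt_le_rpow {f f' : ℝ → ℝ} {A e x y : ℝ} (he : e ≠ 0) (hx : 0 ≤ x)
    (hxe : 0 < x ∨ 0 < e) (hxy : x ≤ y) (hf : ContinuousOn f (Icc x y))
    (hf' : ∀ r ∈ Ioo x y, HasDerivAt f (f' r) r) (hle : ∀ r ∈ Ioo x y, f' r ≤ A * r ^ (e - 1)) :
    f y - f x ≤ A / e * (y ^ e - x ^ e) := by
  have hanti : AntitoneOn (fun r => f r - A / e * r ^ e) (Icc x y) := by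
    refine antitoneOn_of_hasDerivWithinAt_nonpos (convex_Icc x y)
      (f' := fun r => f' r - A / e * (e * r ^ (e - 1))) ?_ (fun r hr => ?_) fun r hr => ?_
    · exact hf.sub (continuousOn_const.mul (continuousOn_id.rpow_const fun r hr =>
        hxe.imp (fun hx => (hx.trans_le hr.1).ne') le_of_lt))
    · rw [interior_Icc] at hr
      exact ((hf' r hr).sub ((Real.hasDerivAt_rpow_const
        (Or.inl (hx.trans_lt hr.1).ne')).const_mul _)).hasDerivWithinAt
    · rw [interior_Icc] at hr
      rw [← mul_assoc, div_mul_cancel₀ A he, sub_nonpos]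
      exact hle r hr
  have h := hanti ⟨le_rfl, hxy⟩ ⟨hxy, le_rfl⟩ hxy
  simp only at h
  linarith

section Pohozaev

variable {n : ℕ} {m q γ a : ℝ} {K u : ℝ → ℝ}

/-- The density `r^(-n) P(r)` of the Pohozaev functional `P`. -/
def pohozaevDensity (n : ℕ) (m q γ : ℝ) (K u : ℝ → ℝ) (r : ℝ) : ℝ :=
  (r * fluxAvg n q K u r) ^ (1 + m) / (1 + m) + K r * u r ^ q / q - u r * fluxAvg n q K u r / γ

/-- The Pohozaev functional of a radial function; along a shot its derivative is
`rⁿ K'(r) u(r)^q / q`, so it is constant when `K` is. -/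
def pohozaev (n : ℕ) (m q γ : ℝ) (K u : ℝ → ℝ) (r : ℝ) : ℝ :=
  r ^ n * pohozaevDensity n m q γ K u r

namespace ShootingData

lemma n_mul_m (h : ShootingData n m q γ K) : (n : ℝ) * m = (1 + m) / γ + (1 + m) := by
  have hγ := h.γ_pos
  have hqm := h.q_mul
  rw [h.q_eq] at hqm
  field_simp
  linear_combination hqm

lemma q_div_mul_m (h : ShootingData n m q γ K) : q / (1 + m) * m = 1 + γ := by
  have hm := h.one_le_m
  field_simp
  linear_combination h.q_mul

lemma criticalRate_pos (h : ShootingData n m q γ K) : 0 < (1 + m) / γ :=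
  div_pos (by linarith [h.one_le_m]) h.γ_pos

lemma rpow_one_add_mul_fluxAvg (h : ShootingData n m q γ K) (u : ℝ → ℝ) {r : ℝ} (hr : 0 ≤ r) :
    (r * fluxAvg n q K u r) ^ (1 + m) = r * fluxAvg n q K u r * radialSlope n m q K u r :=
  Real.rpow_one_add' (mul_nonneg hr (h.fluxAvg_nonneg u hr)) (by linarith [h.one_le_m])

lemma continuous_pohozaev (h : ShootingData n m q γ K) (hu : Continuous u) :
    Continuous (pohozaev n m q γ K u) := by
  have hg := h.continuous_fluxAvg hu
  have hslope : Continuous fun r => (r * fluxAvg n q K u r) ^ (1 + m) :=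
    (continuous_id.mul hg).rpow_const fun _ => Or.inr (by linarith [h.one_le_m])
  have hpow : Continuous fun r => u r ^ q :=
    hu.rpow_const fun _ => Or.inr (by linarith [h.two_le_q])
  have hK := h.cont
  unfold pohozaev pohozaevDensity
  fun_prop

lemma deriv_nonneg (h : ShootingData n m q γ K) (r : ℝ) : 0 ≤ deriv K r := h.mono.deriv_nonneg

lemma pohozaev_zero (h : ShootingData n m q γ K) (u : ℝ → ℝ) : pohozaev n m q γ K u 0 = 0 := by
  rw [pohozaev, zero_pow h.n_pos.ne', zero_mul]

-- With `g = fluxAvg`, `D = -u'`, `U = u^(q-1)`, `k = K` and `k' = K'` at `r`, the left-hand side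
-- is the derivative of the Pohozaev functional computed by the product rule.
lemma pohozaev_deriv_identity (h : ShootingData n m q γ K) {r g D U w k k' : ℝ} (hr : r ≠ 0) :
    n * r ^ (n - 1) * (r * g * D / (1 + m) + k * (w * U) / q - w * g / γ)
      + r ^ n * ((g + r * ((k * U - n * g) / r)) * (1 + m) * D / (1 + m)
        + (k' * (w * U) + k * (-D * q * U)) / q - (-D * g + w * ((k * U - n * g) / r)) / γ)
      = r ^ n * (k' * (w * U) / q) := by
  have hm : 1 + m ≠ 0 := by linarith [h.one_le_m]
  have hγ := h.γ_pos.ne'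
  have hn : (n : ℝ) ≠ 0 := Nat.cast_ne_zero.2 h.n_pos.ne'
  have hpow : r ^ n = r ^ (n - 1) * r := by rw [← pow_succ, Nat.sub_add_cancel h.n_pos]
  have hdim : 1 / γ - n + 1 + n / (1 + m) = 0 := by
    have hnm := h.n_mul_m
    field_simp at hnm ⊢
    linear_combination -hnm
  rw [hpow, h.q_eq]
  calc _ = r ^ (n - 1) * r * (k' * (w * U) / (n * γ))
        + r ^ (n - 1) * r * g * D * (1 / γ - n + 1 + n / (1 + m)) := by
        field_simp
        ring
    _ = _ := by rw [hdim, mul_zero, add_zero]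

end ShootingData

namespace IsShot

lemma hasDerivAt_pohozaev (hu : IsShot n m q K a u) (h : ShootingData n m q γ K) {r : ℝ}
    (hr : 0 < r) (hur : 0 < u r) :
    HasDerivAt (pohozaev n m q γ K u) (r ^ n * (deriv K r * u r ^ q / q)) r := by
  have hm := h.one_le_m
  have hflux := hu.hasDerivAt_fluxAvg h hr
  have hderiv := hu.hasDerivAt h hr
  have hkinetic := (((hasDerivAt_id r).mul hflux).rpow_const (p := 1 + m)
    (Or.inr (by linarith))).div_const (1 + m)
  have hpotential := ((h.diff r hr).hasDerivAt.mul
    (hderiv.rpow_const (p := q) (Or.inl hur.ne'))).div_const q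
  have hmixed := (hderiv.mul hflux).div_const γ
  refine HasDerivAt.congr_deriv (f := pohozaev n m q γ K u)
    ((hasDerivAt_pow n r).mul ((hkinetic.add hpotential).sub hmixed)) ?_
  simp only [Pi.mul_apply, id, one_mul]
  rw [pohozaevDensity, h.rpow_one_add_mul_fluxAvg u hr.le, ← mul_rpow_sub_one_eq hur q,
    radialSource, max_eq_left hur.le, add_sub_cancel_left]
  exact h.pohozaev_deriv_identity hr.ne'

lemma pohozaev_monotoneOn (hu : IsShot n m q K a u) (h : ShootingData n m q γ K) {S : ℝ}
    (hpos : ∀ t ∈ Ico 0 S, 0 < u t) : MonotoneOn (pohozaev n m q γ K u) (Icc 0 S) := by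
  refine monotoneOn_of_hasDerivWithinAt_nonneg (convex_Icc 0 S)
    (h.continuous_pohozaev hu.cont).continuousOn
    (f' := fun r => r ^ n * (deriv K r * u r ^ q / q)) (fun x hx => ?_) fun x hx => ?_
  all_goals
    rw [interior_Icc] at hx
    have hux := hpos x ⟨hx.1.le, hx.2⟩
  · exact (hu.hasDerivAt_pohozaev h hx.1 hux).hasDerivWithinAt
  · have hK := h.deriv_nonneg x
    have hq := h.two_le_q
    have hx0 := hx.1
    positivity

lemma pohozaev_nonneg (hu : IsShot n m q K a u) (h : ShootingData n m q γ K) {S : ℝ}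
    (hpos : ∀ t ∈ Ico 0 S, 0 < u t) {r : ℝ} (hr : r ∈ Icc 0 S) :
    0 ≤ pohozaev n m q γ K u r := by
  rw [← h.pohozaev_zero u]
  exact hu.pohozaev_monotoneOn h hpos ⟨le_rfl, hr.1.trans hr.2⟩ hr hr.1

lemma pohozaev_pos (hu : IsShot n m q K a u) (h : ShootingData n m q γ K)
    {x y : ℝ} (hx : 0 ≤ x) (hxy : x < y) (hK : K x < K y) (hpos : ∀ t ∈ Icc 0 y, 0 < u t) :
    0 < pohozaev n m q γ K u y := by
  have hpos' : ∀ t ∈ Ico 0 y, 0 < u t := fun t ht => hpos t ⟨ht.1, ht.2.le⟩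
  by_contra hneg
  have hzero : ∀ r ∈ Icc 0 y, pohozaev n m q γ K u r = 0 := fun r hr =>
    le_antisymm ((hu.pohozaev_monotoneOn h hpos' hr ⟨hr.1.trans hr.2, le_rfl⟩ hr.2).trans
      (not_lt.1 hneg)) (hu.pohozaev_nonneg h hpos' hr)
  obtain ⟨c, hc, hcK⟩ := exists_deriv_eq_slope K hxy h.cont.continuousOn fun z hz =>
    (h.diff z (hx.trans_lt hz.1)).differentiableWithinAt
  have hc0 : 0 < c := hx.trans_lt hc.1
  have hKc : 0 < deriv K c := by
    rw [hcK]
    exact div_pos (by linarith) (by linarith)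
  have huc := hpos c ⟨hc0.le, hc.2.le⟩
  have hd0 : HasDerivAt (pohozaev n m q γ K u) 0 c := by
    refine (hasDerivAt_const c (0 : ℝ)).congr_of_eventuallyEq ?_
    filter_upwards [Ioo_mem_nhds hc0 hc.2] with z hz using hzero z ⟨hz.1.le, hz.2.le⟩
  have hq := h.two_le_q
  have hdpos : 0 < c ^ n * (deriv K c * u c ^ q / q) := by positivity
  exact hdpos.ne' ((hu.hasDerivAt_pohozaev h hc0 huc).unique hd0)

-- The exponent is chosen so that the derivative has the sign of the Pohozaev functional.
lemma hasDerivAt_fluxAvg_mul_rpow (hu : IsShot n m q K a u) (h : ShootingData n m q γ K) {r : ℝ}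
    (hr : 0 < r) (hur : 0 < u r) :
    HasDerivAt (fun r => fluxAvg n q K u r * u r ^ (-(q / (1 + m))))
      (u r ^ (-(q / (1 + m)) - 1) * (q * pohozaevDensity n m q γ K u r / r)) r := by
  have hm := h.one_le_m
  have hq := h.two_le_q
  have hγ := h.γ_pos
  have hn : (n : ℝ) = q / γ := by rw [h.q_eq, mul_div_cancel_right₀ _ hγ.ne']
  refine ((hu.hasDerivAt_fluxAvg h hr).mul ((hu.hasDerivAt h hr).rpow_const
    (p := -(q / (1 + m))) (Or.inl hur.ne'))).congr_deriv ?_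
  rw [pohozaevDensity, radialSource, max_eq_left hur.le, h.rpow_one_add_mul_fluxAvg u hr.le,
    ← mul_rpow_sub_one_eq hur q, ← mul_rpow_sub_one_eq hur (-(q / (1 + m))), hn]
  field_simp
  ring

lemma le_fluxAvg (hu : IsShot n m q K a u) (h : ShootingData n m q γ K) {S : ℝ}
    (hpos : ∀ t ∈ Ico 0 S, 0 < u t) {r : ℝ} (hr : r ∈ Ico 0 S) :
    K 0 / n * a ^ γ * u r ^ (q / (1 + m)) ≤ fluxAvg n q K u r := by
  have hm := h.one_le_m
  have hq := h.two_le_q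
  have hmono : MonotoneOn (fun r => fluxAvg n q K u r * u r ^ (-(q / (1 + m)))) (Ico 0 S) := by
    refine monotoneOn_of_hasDerivWithinAt_nonneg (convex_Ico 0 S)
      ((h.continuous_fluxAvg hu.cont).continuousOn.mul
        (hu.cont.continuousOn.rpow_const fun x hx => Or.inl (hpos x hx).ne'))
      (f' := fun r => u r ^ (-(q / (1 + m)) - 1) * (q * pohozaevDensity n m q γ K u r / r))
      (fun x hx => ?_) fun x hx => ?_
    all_goals
      rw [interior_Ico] at hx
      have hux := hpos x ⟨hx.1.le, hx.2⟩
    · exact (hu.hasDerivAt_fluxAvg_mul_rpow h hx.1 hux).hasDerivWithinAt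
    · have hdens : 0 ≤ pohozaevDensity n m q γ K u x := nonneg_of_mul_nonneg_right
        (hu.pohozaev_nonneg h hpos ⟨hx.1.le, hx.2.le⟩) (pow_pos hx.1 n)
      have hx0 := hx.1
      positivity
  have hle := hmono ⟨le_rfl, hr.1.trans_lt hr.2⟩ hr hr.1
  simp only [hu.fluxAvg_zero h, hu.apply_zero] at hle
  have hur := hpos r hr
  have hexp : a ^ (q - 1) * a ^ (-(q / (1 + m))) = a ^ γ := by
    rw [← Real.rpow_add hu.pos]
    congr 1
    have := h.q_div_mul_m
    field_simp at this ⊢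
    linear_combination this
  calc K 0 / n * a ^ γ * u r ^ (q / (1 + m))
      = (K 0 * a ^ (q - 1) / n * a ^ (-(q / (1 + m)))) * u r ^ (q / (1 + m)) := by
        rw [← hexp]
        ring
    _ ≤ (fluxAvg n q K u r * u r ^ (-(q / (1 + m)))) * u r ^ (q / (1 + m)) := by gcongr
    _ = fluxAvg n q K u r := by rw [mul_assoc, rpow_neg_mul_rpow hur, mul_one]

lemma le_radialSlope (hu : IsShot n m q K a u) (h : ShootingData n m q γ K) {S : ℝ}
    (hpos : ∀ t ∈ Ico 0 S, 0 < u t) {r : ℝ} (hr : r ∈ Ico 0 S) :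
    (K 0 / n) ^ m * a ^ (γ * m) * u r ^ (1 + γ) * r ^ m ≤ radialSlope n m q K u r := by
  have hur := hpos r hr
  have ha := hu.pos
  have hK := h.pos 0
  have hr0 := hr.1
  have hmul : (K 0 / n) ^ m * a ^ (γ * m) * u r ^ (1 + γ) * r ^ m
      = (r * (K 0 / n * a ^ γ * u r ^ (q / (1 + m)))) ^ m := by
    rw [Real.mul_rpow hr0 (by positivity), Real.mul_rpow (by positivity) (by positivity),
      Real.mul_rpow (by positivity) (by positivity), ← Real.rpow_mul ha.le,
      ← Real.rpow_mul hur.le, h.q_div_mul_m, mul_comm]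
  rw [hmul]
  refine Real.rpow_le_rpow (by positivity) ?_ (by linarith [h.one_le_m])
  exact mul_le_mul_of_nonneg_left (hu.le_fluxAvg h hpos hr) hr0

lemma rpow_mul_rpow_le_one (hu : IsShot n m q K a u) (h : ShootingData n m q γ K) {S : ℝ}
    (hpos : ∀ t ∈ Ico 0 S, 0 < u t) {r : ℝ} (hr : r ∈ Ico 0 S) :
    γ * ((K 0 / n) ^ m * a ^ (γ * m)) / (1 + m) * r ^ (1 + m) * u r ^ γ ≤ 1 := by
  have hm := h.one_le_m
  have hγ := h.γ_pos
  set c := (K 0 / n) ^ m * a ^ (γ * m)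
  have hsubset : Icc 0 r ⊆ Ico 0 S := fun x hx => ⟨hx.1, hx.2.trans_lt hr.2⟩
  have hgrowth := sub_le_of_hasDerivAt_le_rpow (f := fun x => -u x ^ (-γ)) (A := -(γ * c))
    (e := 1 + m) (f' := fun x => -(-radialSlope n m q K u x * -γ * u x ^ (-γ - 1)))
    (by linarith) le_rfl (Or.inr (by linarith)) hr.1
    (hu.cont.continuousOn.rpow_const fun x hx => Or.inl (hpos x (hsubset hx)).ne').neg
    (fun x hx => ((hu.hasDerivAt h hx.1).rpow_const
      (Or.inl (hpos x (hsubset (Ioo_subset_Icc_self hx))).ne')).neg) fun x hx => ?_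
  · have hur := hpos r hr
    have ha : 0 < a ^ (-γ) := Real.rpow_pos_of_pos hu.pos _
    simp only [hu.apply_zero] at hgrowth
    rw [Real.zero_rpow (by linarith), sub_zero, neg_div] at hgrowth
    calc γ * c / (1 + m) * r ^ (1 + m) * u r ^ γ ≤ u r ^ (-γ) * u r ^ γ := by
          gcongr
          linarith
      _ = 1 := rpow_neg_mul_rpow hur γ
  · have hux := hpos x (hsubset (Ioo_subset_Icc_self hx))
    have hslope := hu.le_radialSlope h hpos (hsubset (Ioo_subset_Icc_self hx))
    have hcancel : u x ^ (-γ - 1) * u x ^ (1 + γ) = 1 := by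
      rw [show -γ - 1 = -(1 + γ) by ring, rpow_neg_mul_rpow hux]
    rw [add_sub_cancel_left]
    calc -(-radialSlope n m q K u x * -γ * u x ^ (-γ - 1))
        = -(γ * u x ^ (-γ - 1) * radialSlope n m q K u x) := by ring
      _ ≤ -(γ * u x ^ (-γ - 1) * (c * u x ^ (1 + γ) * x ^ m)) := by gcongr
      _ = -(γ * c) * x ^ m := by linear_combination -(γ * c * x ^ m) * hcancel

end IsShot

lemma ShootingData.exists_decay (h : ShootingData n m q γ K) :
    ∃ c : ℝ, 0 < c ∧ ∀ (a : ℝ) (u : ℝ → ℝ), IsShot n m q K a u → ∀ S : ℝ,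
      (∀ t ∈ Ico 0 S, 0 < u t) → ∀ r ∈ Ioo 0 S, c * a ^ m * r ^ ((1 + m) / γ) * u r ≤ 1 := by
  have hm := h.one_le_m
  have hγ := h.γ_pos
  have hn := h.n_pos
  have hK := h.pos 0
  set c := γ * (K 0 / n) ^ m / (1 + m) with hc
  refine ⟨c ^ (1 / γ), by positivity, fun a u hu S hpos r hr => ?_⟩
  have hur := hpos r ⟨hr.1.le, hr.2⟩
  have ha := hu.pos
  have hr0 := hr.1
  refine le_of_not_gt fun hgt => (Real.one_lt_rpow hgt hγ).not_ge ?_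
  calc (c ^ (1 / γ) * a ^ m * r ^ ((1 + m) / γ) * u r) ^ γ
      = γ * ((K 0 / n) ^ m * a ^ (γ * m)) / (1 + m) * r ^ (1 + m) * u r ^ γ := by
        rw [Real.mul_rpow (by positivity) hur.le, Real.mul_rpow (by positivity) (by positivity),
          Real.mul_rpow (by positivity) (by positivity), ← Real.rpow_mul (by positivity),
          ← Real.rpow_mul ha.le, ← Real.rpow_mul hr0.le, div_mul_cancel₀ _ hγ.ne',
          div_mul_cancel₀ _ hγ.ne', Real.rpow_one, mul_comm m γ, hc]
        ring
    _ ≤ 1 := hu.rpow_mul_rpow_le_one h hpos ⟨hr.1.le, hr.2⟩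

end Pohozaev

/-! ### The first zero of a shot -/

lemma mul_rpow_eq_pow_mul_rpow {r g : ℝ} (n : ℕ) (e : ℝ) (hr : 0 < r) (hg : 0 ≤ g) :
    (r * g) ^ e = (r ^ n * g) ^ e * r ^ ((1 - n) * e) := by
  rw [Real.rpow_mul hr.le, ← Real.mul_rpow (by positivity) (by positivity), mul_right_comm,
    ← Real.rpow_natCast, ← Real.rpow_add hr, add_sub_cancel, Real.rpow_one]

lemma tendsto_atTop_of_div_le_hasDerivAt {f f' : ℝ → ℝ} {κ b : ℝ} (hκ : 0 < κ) (hb : 0 < b)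
    (hf : ∀ r, b ≤ r → HasDerivAt f (f' r) r) (hle : ∀ r, b ≤ r → κ / r ≤ f' r) :
    Tendsto f atTop atTop := by
  have hsub : ∀ r, b ≤ r → HasDerivAt (fun r => f r - κ * Real.log r) (f' r - κ * r⁻¹) r :=
    fun r hr => (hf r hr).sub ((Real.hasDerivAt_log (hb.trans_le hr).ne').const_mul κ)
  have hmono : MonotoneOn (fun r => f r - κ * Real.log r) (Ici b) := by
    refine monotoneOn_of_hasDerivWithinAt_nonneg (convex_Ici b)
      (fun r hr => (hsub r hr).continuousAt.continuousWithinAt)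
      (fun r hr => (hsub r (interior_subset hr)).hasDerivWithinAt) fun r hr => ?_
    rw [sub_nonneg, ← div_eq_mul_inv]
    exact hle r (interior_subset hr)
  refine tendsto_atTop_mono' atTop ?_
    (tendsto_atTop_add_const_left _ (f b - κ * Real.log b)
      (Real.tendsto_log_atTop.const_mul_atTop hκ))
  filter_upwards [eventually_ge_atTop b] with r hr
  have hbr := hmono self_mem_Ici hr hr
  simp only at hbr
  linarith

/-- The flux `∫₀ʳ tⁿ⁻¹ K(t) u₊(t)^(q-1) dt`. -/
def radialFlux (n : ℕ) (q : ℝ) (K u : ℝ → ℝ) (r : ℝ) : ℝ := r ^ n * fluxAvg n q K u r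

section FirstZero

variable {n : ℕ} {m q γ a : ℝ} {K u : ℝ → ℝ}

namespace ShootingData

lemma radialFlux_nonneg (h : ShootingData n m q γ K) (u : ℝ → ℝ) {r : ℝ} (hr : 0 ≤ r) :
    0 ≤ radialFlux n q K u r :=
  mul_nonneg (pow_nonneg hr n) (h.fluxAvg_nonneg u hr)

lemma hasDerivAt_radialFlux (h : ShootingData n m q γ K) (hu : Continuous u) (r : ℝ) :
    HasDerivAt (radialFlux n q K u) (r ^ (n - 1) * radialSource q K u r) r :=
  hasDerivAt_pow_mul_ballAvg h.n_pos (h.continuous_radialSource hu) r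

lemma monotoneOn_radialFlux (h : ShootingData n m q γ K) (hu : Continuous u) :
    MonotoneOn (radialFlux n q K u) (Ici 0) :=
  monotoneOn_of_hasDerivWithinAt_nonneg (convex_Ici 0)
    (fun x _ => (h.hasDerivAt_radialFlux hu x).continuousAt.continuousWithinAt)
    (fun x _ => (h.hasDerivAt_radialFlux hu x).hasDerivWithinAt) fun x hx =>
      mul_nonneg (pow_nonneg (interior_subset hx) _) (h.radialSource_nonneg u x)

lemma radialSlope_eq (h : ShootingData n m q γ K) (u : ℝ → ℝ) {r : ℝ} (hr : 0 < r) :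
    radialSlope n m q K u r = radialFlux n q K u r ^ m * r ^ (-((1 + m) / γ) - 1) := by
  rw [radialSlope, mul_rpow_eq_pow_mul_rpow n m hr (h.fluxAvg_nonneg u hr.le), radialFlux]
  congr 2
  linear_combination -h.n_mul_m

lemma pohozaev_eq (h : ShootingData n m q γ K) (u : ℝ → ℝ) {r : ℝ} (hr : 0 < r) :
    pohozaev n m q γ K u r = radialFlux n q K u r ^ (1 + m) / (1 + m) * r ^ (-((1 + m) / γ))
      + r ^ n * (K r * u r ^ q / q) - u r * radialFlux n q K u r / γ := by
  have hkinetic : r ^ n * (r * fluxAvg n q K u r) ^ (1 + m)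
      = radialFlux n q K u r ^ (1 + m) * r ^ (-((1 + m) / γ)) := by
    rw [mul_rpow_eq_pow_mul_rpow n (1 + m) hr (h.fluxAvg_nonneg u hr.le), mul_left_comm,
      ← Real.rpow_natCast, ← Real.rpow_add hr, Real.rpow_natCast, radialFlux]
    congr 2
    linear_combination -h.n_mul_m
  rw [pohozaev, pohozaevDensity, radialFlux] at *
  linear_combination hkinetic / (1 + m)

end ShootingData

namespace IsShot

lemma radialFlux_rpow_le (hu : IsShot n m q K a u) (h : ShootingData n m q γ K)
    (hpos : ∀ t, 0 ≤ t → 0 < u t) {r : ℝ} (hr : 0 < r) :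
    radialFlux n q K u r ^ m ≤ (1 + m) / γ * (r ^ ((1 + m) / γ) * u r) := by
  have hl := h.criticalRate_pos
  have hflux := h.radialFlux_nonneg u hr.le
  set l := (1 + m) / γ
  set V := radialFlux n q K u r ^ m
  have hdrop : ∀ x, r ≤ x → V / l * r ^ (-l) - V / l * x ^ (-l) ≤ u r := fun x hx => by
    have hle := sub_le_of_hasDerivAt_le_rpow (f := u) (A := -V) (e := -l) (neg_ne_zero.2 hl.ne')
      hr.le (Or.inl hr) hx hu.cont.continuousOn (fun z hz => hu.hasDerivAt h (hr.trans hz.1))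
      fun z hz => ?_
    · rw [neg_div_neg_eq] at hle
      linarith [hpos x (hr.le.trans hx)]
    · have hz0 : 0 < z := hr.trans hz.1
      have hmono := h.monotoneOn_radialFlux hu.cont hr.le hz0.le hz.1.le
      rw [h.radialSlope_eq u hz0, neg_mul]
      gcongr
      exact Real.rpow_le_rpow hflux hmono (by linarith [h.one_le_m])
  have hlim : Tendsto (fun x : ℝ => V / l * r ^ (-l) - V / l * x ^ (-l)) atTop
      (𝓝 (V / l * r ^ (-l) - V / l * 0)) :=
    ((tendsto_rpow_neg_atTop hl).const_mul _).const_sub _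
  have hle : V / l * r ^ (-l) ≤ u r := by
    simpa using le_of_tendsto hlim ((eventually_ge_atTop r).mono hdrop)
  calc V = l * (r ^ l * (V / l * r ^ (-l))) := by
        have hVl : l * (V / l) = V := mul_div_cancel₀ V hl.ne'
        linear_combination -hVl - V / l * l * rpow_neg_mul_rpow hr l
    _ ≤ l * (r ^ l * u r) := by gcongr

lemma exists_radialFlux_le (hu : IsShot n m q K a u) (h : ShootingData n m q γ K)
    (hpos : ∀ t, 0 ≤ t → 0 < u t) : ∃ B : ℝ, ∀ r, 0 < r → radialFlux n q K u r ≤ B := by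
  obtain ⟨c, hc, hdecay⟩ := h.exists_decay
  have hm := h.one_le_m
  have hl := h.criticalRate_pos
  have ha := hu.pos
  refine ⟨((1 + m) / γ / (c * a ^ m)) ^ m⁻¹, fun r hr => ?_⟩
  rw [Real.le_rpow_inv_iff_of_pos (h.radialFlux_nonneg u hr.le) (by positivity) (by linarith),
    le_div_iff₀ (by positivity)]
  have hdec := hdecay a u hu (r + 1) (fun t ht => hpos t ht.1) r ⟨hr, by linarith⟩
  calc radialFlux n q K u r ^ m * (c * a ^ m)
      ≤ (1 + m) / γ * (r ^ ((1 + m) / γ) * u r) * (c * a ^ m) := by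
        gcongr
        exact hu.radialFlux_rpow_le h hpos hr
    _ = (1 + m) / γ * (c * a ^ m * r ^ ((1 + m) / γ) * u r) := by ring
    _ ≤ (1 + m) / γ := mul_le_of_le_one_right hl.le hdec

lemma exists_eventually_le_pow_mul (hu : IsShot n m q K a u) (h : ShootingData n m q γ K)
    (hstrict : ∃ x y, 0 ≤ x ∧ x < y ∧ K x < K y) (hpos : ∀ t, 0 ≤ t → 0 < u t) :
    ∃ δ : ℝ, 0 < δ ∧ ∀ᶠ r in atTop, δ ≤ r ^ n * (K r * u r ^ q) := by
  obtain ⟨x, y, hx, hxy, hKxy⟩ := hstrict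
  obtain ⟨B, hB⟩ := hu.exists_radialFlux_le h hpos
  have hm := h.one_le_m
  have hq : 0 < q := by linarith [h.two_le_q]
  have hP : 0 < pohozaev n m q γ K u y := hu.pohozaev_pos h hx hxy hKxy fun t ht => hpos t ht.1
  set P := pohozaev n m q γ K u y
  have hkinetic : Tendsto (fun r : ℝ => B ^ (1 + m) / (1 + m) * r ^ (-((1 + m) / γ))) atTop
      (𝓝 (B ^ (1 + m) / (1 + m) * 0)) := (tendsto_rpow_neg_atTop h.criticalRate_pos).const_mul _
  rw [mul_zero] at hkinetic
  refine ⟨q * (P / 2), by positivity, ?_⟩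
  filter_upwards [hkinetic.eventually (gt_mem_nhds (half_pos hP)), eventually_gt_atTop 0,
    eventually_ge_atTop y] with r hsmall hr hyr
  have hPr : P ≤ pohozaev n m q γ K u r :=
    hu.pohozaev_monotoneOn h (fun t ht => hpos t ht.1) ⟨hx.trans hxy.le, hyr⟩ ⟨hr.le, le_rfl⟩ hyr
  have hflux := h.radialFlux_nonneg u hr.le
  have hle : radialFlux n q K u r ^ (1 + m) / (1 + m) * r ^ (-((1 + m) / γ))
      ≤ B ^ (1 + m) / (1 + m) * r ^ (-((1 + m) / γ)) := by
    gcongr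
    exact hB r hr
  have hmixed : 0 ≤ u r * radialFlux n q K u r / γ :=
    div_nonneg (mul_nonneg (hpos r hr.le).le hflux) h.γ_pos.le
  rw [h.pohozaev_eq u hr] at hPr
  calc q * (P / 2) ≤ q * (r ^ n * (K r * u r ^ q / q)) := by
        gcongr
        linarith
    _ = r ^ n * (K r * u r ^ q) := by field_simp

-- Were the shot positive forever, its flux would be bounded by the decay estimate, while a positive
-- Pohozaev functional makes the flux grow at least logarithmically.
lemma exists_nonpos (hu : IsShot n m q K a u) (h : ShootingData n m q γ K)
    (hstrict : ∃ x y, 0 ≤ x ∧ x < y ∧ K x < K y) : ∃ r, 0 ≤ r ∧ u r ≤ 0 := by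
  by_contra! hpos
  obtain ⟨B, hB⟩ := hu.exists_radialFlux_le h hpos
  obtain ⟨δ, hδ, hev⟩ := hu.exists_eventually_le_pow_mul h hstrict hpos
  obtain ⟨b, hb⟩ := ((eventually_gt_atTop 0).and hev).exists_forall_of_atTop
  have hgrowth : ∀ r, b ≤ r → δ / a / r ≤ r ^ (n - 1) * radialSource q K u r := fun r hr => by
    obtain ⟨hr0, hδr⟩ := hb r hr
    have hur := hpos r hr0.le
    have hsource : 0 ≤ r ^ (n - 1) * radialSource q K u r :=
      mul_nonneg (pow_nonneg hr0.le _) (h.radialSource_nonneg u r)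
    rw [div_div, div_le_iff₀ (mul_pos hu.pos hr0)]
    calc δ ≤ r ^ n * (K r * u r ^ q) := hδr
      _ = r ^ (n - 1) * radialSource q K u r * (u r * r) := by
        rw [radialSource, max_eq_left hur.le, ← mul_rpow_sub_one_eq hur q,
          ← mul_pow_sub_one h.n_pos.ne' r]
        ring
      _ ≤ r ^ (n - 1) * radialSource q K u r * (a * r) := by
        gcongr
        exact hu.le_init h hr0.le
  have htop := tendsto_atTop_of_div_le_hasDerivAt (div_pos hδ hu.pos) (hb b le_rfl).1
    (fun r _ => h.hasDerivAt_radialFlux hu.cont r) hgrowth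
  obtain ⟨r, hr, hBr⟩ := ((eventually_gt_atTop 0).and (htop.eventually_gt_atTop B)).exists
  exact hBr.not_ge (hB r hr)

end IsShot

/-! ### Lower bounds for the first zero -/

namespace IsShot

lemma init_mul_le (hu : IsShot n m q K a u) (h : ShootingData n m q γ K) {r M : ℝ}
    (hr : 0 ≤ r) (hrM : r ≤ M) :
    a * (1 - r ^ (1 + m) * K M ^ m * a ^ (γ * (1 + m))) ≤ u r := by
  have hm := h.one_le_m
  have hγ := h.γ_pos
  have ha := hu.pos
  have hKr := h.pos r
  have hpow : a ^ ((q - 1) * m) = a * a ^ (γ * (1 + m)) := by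
    rw [← Real.rpow_one_add' ha.le (by positivity)]
    congr 1
    linear_combination h.q_mul
  have hdrop : r * (r * (K r * a ^ (q - 1))) ^ m
      ≤ a * (r ^ (1 + m) * K M ^ m * a ^ (γ * (1 + m))) := by
    rw [Real.mul_rpow hr (by positivity), Real.mul_rpow hKr.le (by positivity),
      ← Real.rpow_mul ha.le, hpow, Real.rpow_one_add' hr (by linarith)]
    calc r * (r ^ m * (K r ^ m * (a * a ^ (γ * (1 + m)))))
        = a * (r * r ^ m * K r ^ m * a ^ (γ * (1 + m))) := by ring
      _ ≤ a * (r * r ^ m * K M ^ m * a ^ (γ * (1 + m))) := by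
        gcongr
        exact h.mono hrM
  linarith [hu.init_sub_le h hr]

lemma one_le_of_apply_eq_zero (hu : IsShot n m q K a u) (h : ShootingData n m q γ K) {R M : ℝ}
    (hR : 0 ≤ R) (hRM : R ≤ M) (huR : u R = 0) :
    1 ≤ R ^ (1 + m) * K M ^ m * a ^ (γ * (1 + m)) :=
  sub_nonpos.1 (nonpos_of_mul_nonpos_right (huR ▸ hu.init_mul_le h hR hRM) hu.pos)

end IsShot

lemma ShootingData.exists_half_le (h : ShootingData n m q γ K) (M : ℝ) :
    ∃ c : ℝ, 0 < c ∧ ∀ (a : ℝ) (u : ℝ → ℝ), IsShot n m q K a u →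
      ∀ r, 0 ≤ r → r ≤ M → r ≤ c * a ^ (-γ) → a / 2 ≤ u r := by
  have hm := h.one_le_m
  have hKM := h.pos M
  refine ⟨(1 / (2 * K M ^ m)) ^ (1 / (1 + m)), by positivity, fun a u hu r hr hrM hrc => ?_⟩
  have ha := hu.pos
  have hr_pow : r ^ (1 + m) ≤ 1 / (2 * K M ^ m) * a ^ (-(γ * (1 + m))) := by
    refine (Real.rpow_le_rpow hr hrc (by linarith)).trans_eq ?_
    rw [Real.mul_rpow (by positivity) (by positivity), ← Real.rpow_mul (by positivity),
      ← Real.rpow_mul ha.le, div_mul_cancel₀ _ (by linarith), Real.rpow_one, neg_mul]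
  have hdrop : r ^ (1 + m) * K M ^ m * a ^ (γ * (1 + m)) ≤ 1 / 2 := by
    calc r ^ (1 + m) * K M ^ m * a ^ (γ * (1 + m))
        ≤ 1 / (2 * K M ^ m) * a ^ (-(γ * (1 + m))) * K M ^ m * a ^ (γ * (1 + m)) := by gcongr
      _ = 1 / (2 * K M ^ m) * K M ^ m * (a ^ (-(γ * (1 + m))) * a ^ (γ * (1 + m))) := by ring
      _ = 1 / 2 := by
        rw [rpow_neg_mul_rpow ha]
        field_simp
  nlinarith [hu.init_mul_le h hr hrM]

section Flatness

variable {M C l : ℝ}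

lemma pow_mul_deriv_le {k' r U V : ℝ} (hr : 0 < r) (hq : 0 ≤ q) (hk' : 0 ≤ k')
    (hle : r * k' ≤ C * r ^ l) (hU : 0 ≤ U) (hUV : U ≤ V) :
    r ^ n * (k' * U / q) ≤ C / q * V * r ^ (n + l - 1) := by
  have hpow : r ^ n = r ^ ((n : ℝ) - 1) * r := by
    rw [← Real.rpow_add_one hr.ne', sub_add_cancel, Real.rpow_natCast]
  have hrpow : r ^ (n + l - 1) = r ^ ((n : ℝ) - 1) * r ^ l := by
    rw [← Real.rpow_add hr]
    ring_nf
  have hCr : 0 ≤ C * r ^ l := le_trans (by positivity) hle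
  calc r ^ n * (k' * U / q) = r ^ ((n : ℝ) - 1) * (r * k') * U / q := by
        rw [hpow]
        ring
    _ ≤ r ^ ((n : ℝ) - 1) * (C * r ^ l) * V / q := by gcongr
    _ = C / q * V * r ^ (n + l - 1) := by
        rw [hrpow]
        ring

namespace IsShot

lemma pohozaev_le_rpow (hu : IsShot n m q K a u) (h : ShootingData n m q γ K)
    (hl : 0 < l) (hK' : ∀ r ∈ Ioc 0 M, r * deriv K r ≤ C * r ^ l) {r : ℝ} (hr : 0 ≤ r)
    (hrM : r ≤ M) (hpos : ∀ t ∈ Ico 0 r, 0 < u t) :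
    pohozaev n m q γ K u r ≤ C / q * a ^ q / (n + l) * r ^ (n + l) := by
  have hq := h.two_le_q
  have he : 0 < n + l := by positivity
  have hle := sub_le_of_hasDerivAt_le_rpow he.ne' le_rfl (Or.inr he) hr
    (h.continuous_pohozaev hu.cont).continuousOn
    (fun x hx => hu.hasDerivAt_pohozaev h hx.1 (hpos x ⟨hx.1.le, hx.2⟩)) fun x hx => by
      have hux := (hpos x ⟨hx.1.le, hx.2⟩).le
      exact pow_mul_deriv_le hx.1 (by linarith) (h.deriv_nonneg x)
        (hK' x ⟨hx.1, hx.2.le.trans hrM⟩) (Real.rpow_nonneg hux q)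
        (Real.rpow_le_rpow hux (hu.le_init h hx.1.le) (by linarith))
  rwa [h.pohozaev_zero, Real.zero_rpow he.ne', sub_zero, sub_zero] at hle

lemma rpow_le_of_decay (hu : IsShot n m q K a u) (h : ShootingData n m q γ K) {c r : ℝ}
    (hc : 0 < c) (hr : 0 < r) (hur : 0 < u r)
    (hdecay : c * a ^ m * r ^ ((1 + m) / γ) * u r ≤ 1) :
    u r ^ q ≤ (c * a ^ m) ^ (-q) * r ^ (-(n * (1 + m))) := by
  have ha := hu.pos
  have hγ := h.γ_pos
  have hle : u r ≤ (c * a ^ m * r ^ ((1 + m) / γ))⁻¹ := by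
    rwa [← one_div, le_div_iff₀' (by positivity)]
  have hexp : (1 + m) / γ * -q = -(n * (1 + m)) := by
    rw [h.q_eq]
    field_simp
  refine (Real.rpow_le_rpow hur.le hle (by linarith [h.two_le_q])).trans_eq ?_
  rw [Real.inv_rpow (by positivity), ← Real.rpow_neg (by positivity),
    Real.mul_rpow (by positivity) (by positivity), ← Real.rpow_mul hr.le, hexp]

lemma pohozaev_sub_le_rpow (hu : IsShot n m q K a u) (h : ShootingData n m q γ K)
    (hln : l < n * m) (hC : 0 ≤ C) (hK' : ∀ r ∈ Ioc 0 M, r * deriv K r ≤ C * r ^ l) {R c : ℝ}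
    (hRM : R ≤ M) (hpos : ∀ t ∈ Ico 0 R, 0 < u t) (hc : 0 < c)
    (hdecay : ∀ r ∈ Ioo 0 R, c * a ^ m * r ^ ((1 + m) / γ) * u r ≤ 1)
    {r₀ : ℝ} (hr₀ : 0 < r₀) (hrR : r₀ ≤ R) :
    pohozaev n m q γ K u R - pohozaev n m q γ K u r₀
      ≤ C / q * (c * a ^ m) ^ (-q) / (n * m - l) * r₀ ^ (l - n * m) := by
  have hq := h.two_le_q
  have ha := hu.pos
  have : 0 < n * m - l := sub_pos.2 hln
  have hle := sub_le_of_hasDerivAt_le_rpow (A := C / q * (c * a ^ m) ^ (-q)) (e := l - n * m)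
    (by linarith) hr₀.le (Or.inl hr₀) hrR (h.continuous_pohozaev hu.cont).continuousOn
    (fun x hx => hu.hasDerivAt_pohozaev h (hr₀.trans hx.1)
      (hpos x ⟨(hr₀.trans hx.1).le, hx.2⟩)) fun x hx => by
      have hx0 := hr₀.trans hx.1
      have hux := hpos x ⟨hx0.le, hx.2⟩
      refine (pow_mul_deriv_le hx0 (by linarith) (h.deriv_nonneg x)
        (hK' x ⟨hx0, hx.2.le.trans hRM⟩) (Real.rpow_nonneg hux.le q)
        (hu.rpow_le_of_decay h hc hx0 hux (hdecay x ⟨hx0, hx.2⟩))).trans_eq ?_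
      rw [← mul_assoc, mul_assoc _ (x ^ _), ← Real.rpow_add hx0]
      ring_nf
  have hR : 0 ≤ C / q * (c * a ^ m) ^ (-q) / (n * m - l) * R ^ (l - n * m) :=
    mul_nonneg (by positivity) (Real.rpow_nonneg (hr₀.le.trans hrR) _)
  rw [← neg_sub ((n : ℝ) * m) l, div_neg, neg_sub] at hle
  linarith

lemma le_radialFlux (hu : IsShot n m q K a u) (h : ShootingData n m q γ K) {c R : ℝ}
    (hc : 0 < c) (hpos : ∀ t ∈ Ico 0 R, 0 < u t) (hcR : c * a ^ (-γ) < R)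
    (hhalf : a / 2 ≤ u (c * a ^ (-γ))) :
    c ^ n * (K 0 / n * (1 / 2) ^ (q / (1 + m))) * a ^ (-1 : ℝ) ≤ radialFlux n q K u R := by
  have hm := h.one_le_m
  have hq := h.two_le_q
  have ha := hu.pos
  have hK := h.pos 0
  set r := c * a ^ (-γ) with hrdef
  set β := q / (1 + m)
  have hr : 0 < r := by positivity
  have hpow : r ^ n = c ^ n * a ^ (-q) := by
    rw [hrdef, mul_pow, ← Real.rpow_mul_natCast ha.le, h.q_eq]
    ring_nf
  have hexp : a ^ (-1 : ℝ) = a ^ (-q) * a ^ γ * a ^ β := by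
    rw [← Real.rpow_add ha, ← Real.rpow_add ha]
    congr 1
    have hβ : β * (1 + m) = q := div_mul_cancel₀ _ (by linarith)
    linear_combination h.q_div_mul_m - hβ
  calc c ^ n * (K 0 / n * (1 / 2) ^ β) * a ^ (-1 : ℝ)
      = r ^ n * (K 0 / n * a ^ γ * (a / 2) ^ β) := by
        rw [div_eq_mul_one_div a, Real.mul_rpow ha.le (by norm_num), hpow, hexp]
        ring
    _ ≤ r ^ n * (K 0 / n * a ^ γ * u r ^ β) := by gcongr
    _ ≤ radialFlux n q K u r := by
        rw [radialFlux]
        gcongr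
        exact hu.le_fluxAvg h hpos ⟨hr.le, hcR⟩
    _ ≤ radialFlux n q K u R := h.monotoneOn_radialFlux hu.cont hr.le (hr.trans hcR).le hcR.le

lemma le_pohozaev_of_apply_eq_zero (hu : IsShot n m q K a u) (h : ShootingData n m q γ K)
    {b R : ℝ} (hb : 0 ≤ b) (hR : 0 < R) (huR : u R = 0)
    (hflux : b * a ^ (-1 : ℝ) ≤ radialFlux n q K u R) :
    b ^ (1 + m) / (1 + m) * a ^ (-(1 + m)) * R ^ (-((1 + m) / γ)) ≤ pohozaev n m q γ K u R := by
  have hm := h.one_le_m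
  have ha := hu.pos
  have hpow := Real.rpow_le_rpow (by positivity) hflux (by linarith : 0 ≤ 1 + m)
  rw [Real.mul_rpow hb (by positivity), ← Real.rpow_mul ha.le, neg_one_mul] at hpow
  rw [h.pohozaev_eq u hR, huR, Real.zero_rpow (by linarith [h.two_le_q])]
  calc b ^ (1 + m) / (1 + m) * a ^ (-(1 + m)) * R ^ (-((1 + m) / γ))
      = b ^ (1 + m) * a ^ (-(1 + m)) / (1 + m) * R ^ (-((1 + m) / γ)) := by ring
    _ ≤ radialFlux n q K u R ^ (1 + m) / (1 + m) * R ^ (-((1 + m) / γ)) := by gcongr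
    _ = _ := by ring

-- The Pohozaev bounds on `[0, c a^(-γ)]` and beyond have the same order `a^(-γ l)`.
lemma pohozaev_le_rpow_neg (hu : IsShot n m q K a u) (h : ShootingData n m q γ K)
    (hl : 0 < l) (hln : l < n * m) (hC : 0 ≤ C)
    (hK' : ∀ r ∈ Ioc 0 M, r * deriv K r ≤ C * r ^ l) {R c c' : ℝ} (hRM : R ≤ M)
    (hpos : ∀ t ∈ Ico 0 R, 0 < u t) (hc' : 0 < c')
    (hdecay : ∀ r ∈ Ioo 0 R, c' * a ^ m * r ^ ((1 + m) / γ) * u r ≤ 1)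
    (hc : 0 < c) (hcR : c * a ^ (-γ) ≤ R) :
    pohozaev n m q γ K u R ≤ (C / q / (n + l) * c ^ (n + l)
      + C / q / (n * m - l) * c' ^ (-q) * c ^ (l - n * m)) * a ^ (-(γ * l)) := by
  have ha := hu.pos
  have hr : 0 < c * a ^ (-γ) := by positivity
  have hnear := hu.pohozaev_le_rpow h hl hK' hr.le (hcR.trans hRM)
    fun t ht => hpos t ⟨ht.1, ht.2.trans_le hcR⟩
  have hfar := hu.pohozaev_sub_le_rpow h hln hC hK' hRM hpos hc' hdecay hr hcR
  have hnear_eq : a ^ q * (c * a ^ (-γ)) ^ (n + l) = c ^ (n + l) * a ^ (-(γ * l)) := by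
    rw [Real.mul_rpow hc.le (by positivity), ← Real.rpow_mul ha.le, mul_left_comm,
      ← Real.rpow_add ha, h.q_eq]
    ring_nf
  have hfar_eq : (c' * a ^ m) ^ (-q) * (c * a ^ (-γ)) ^ (l - n * m)
      = c' ^ (-q) * c ^ (l - n * m) * a ^ (-(γ * l)) := by
    rw [Real.mul_rpow hc'.le (by positivity), Real.mul_rpow hc.le (by positivity),
      ← Real.rpow_mul ha.le, ← Real.rpow_mul ha.le, mul_mul_mul_comm, ← Real.rpow_add ha]
    congr 2
    rw [h.q_eq]
    ring
  calc pohozaev n m q γ K u R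
      ≤ C / q * a ^ q / (n + l) * (c * a ^ (-γ)) ^ (n + l)
        + C / q * (c' * a ^ m) ^ (-q) / (n * m - l) * (c * a ^ (-γ)) ^ (l - n * m) := by linarith
    _ = _ := by linear_combination C / q / (n + l) * hnear_eq + C / q / (n * m - l) * hfar_eq

end IsShot

lemma ShootingData.exists_mul_rpow_le_rpow (h : ShootingData n m q γ K) (hl : 0 < l)
    (hln : l < n * m) (hC : 0 < C) (hK' : ∀ r ∈ Ioc 0 M, r * deriv K r ≤ C * r ^ l) :
    ∃ c : ℝ, 0 < c ∧ ∀ (a R : ℝ) (u : ℝ → ℝ), IsShot n m q K a u → 0 < R → R ≤ M → u R = 0 →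
      (∀ t ∈ Ico 0 R, 0 < u t) → c * a ^ (γ * l - (1 + m)) ≤ R ^ ((1 + m) / γ) := by
  have hm := h.one_le_m
  have hq := h.two_le_q
  have hn := h.n_pos
  have hK := h.pos 0
  obtain ⟨c₀, hc₀, hhalf⟩ := h.exists_half_le M
  obtain ⟨c₁, hc₁, hdecay⟩ := h.exists_decay
  have : 0 < n * m - l := sub_pos.2 hln
  set b := c₀ ^ n * (K 0 / n * (1 / 2) ^ (q / (1 + m)))
  have hb : 0 < b := by positivity
  set E := C / q / (n + l) * c₀ ^ (n + l) + C / q / (n * m - l) * c₁ ^ (-q) * c₀ ^ (l - n * m)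
  have hE : 0 < E := by positivity
  refine ⟨b ^ (1 + m) / (1 + m) / E, by positivity, fun a R u hu hR hRM huR hpos => ?_⟩
  have ha := hu.pos
  have hcR : c₀ * a ^ (-γ) < R := not_le.1 fun hle => by
    linarith [hhalf a u hu R hR.le hRM hle]
  have hflux := hu.le_radialFlux h hc₀ hpos hcR
    (hhalf a u hu _ (by positivity) (hcR.le.trans hRM) le_rfl)
  have hP := (hu.le_pohozaev_of_apply_eq_zero h hb.le hR huR hflux).trans
    (hu.pohozaev_le_rpow_neg h hl hln hC.le hK' hRM hpos hc₁ (hdecay a u hu R hpos) hc₀ hcR.le)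
  rw [div_mul_eq_mul_div, div_le_iff₀' hE]
  set D := b ^ (1 + m) / (1 + m)
  have hRR := rpow_neg_mul_rpow hR ((1 + m) / γ)
  have haa := rpow_neg_mul_rpow ha (γ * l)
  calc D * a ^ (γ * l - (1 + m))
      = D * a ^ (-(1 + m)) * R ^ (-((1 + m) / γ)) * (R ^ ((1 + m) / γ) * a ^ (γ * l)) := by
        rw [sub_eq_add_neg, Real.rpow_add ha]
        linear_combination -(D * a ^ (-(1 + m)) * a ^ (γ * l)) * hRR
    _ ≤ E * a ^ (-(γ * l)) * (R ^ ((1 + m) / γ) * a ^ (γ * l)) := by gcongr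
    _ = E * R ^ ((1 + m) / γ) := by linear_combination E * R ^ ((1 + m) / γ) * haa

end Flatness

end FirstZero

/-! ### The zero map -/

lemma continuousAt_of_sign_change {X : Type*} [TopologicalSpace X] {w : X → ℝ → ℝ} {ρ : X → ℝ}
    {a : X} (hw : ∀ r, 0 ≤ r → ContinuousAt (fun b => w b r) a) (hρ : ∀ᶠ b in 𝓝 a, 0 ≤ ρ b)
    (hpos : ∀ᶠ b in 𝓝 a, ∀ r, 0 ≤ r → (0 < w b r ↔ r < ρ b))
    (hneg : ∀ᶠ b in 𝓝 a, ∀ r, 0 ≤ r → (w b r < 0 ↔ ρ b < r)) : ContinuousAt ρ a := by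
  refine tendsto_order.2 ⟨fun x hx => ?_, fun x hx => ?_⟩
  · rcases lt_or_ge x 0 with hx0 | hx0
    · exact hρ.mono fun b hb => hx0.trans_le hb
    · have hwx := (hpos.self_of_nhds x hx0).2 hx
      filter_upwards [(hw x hx0).eventually (lt_mem_nhds hwx), hpos] with b hbx hb
      exact (hb x hx0).1 hbx
  · have hx0 : 0 ≤ x := hρ.self_of_nhds.trans hx.le
    have hwx := (hneg.self_of_nhds x hx0).2 hx
    filter_upwards [(hw x hx0).eventually (gt_mem_nhds hwx), hneg] with b hbx hb
    exact (hb x hx0).1 hbx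

/-- `R > 0` is the first zero of `u` on `[0, ∞)`, where `u` is positive before `R`. -/
structure IsFirstZero (u : ℝ → ℝ) (R : ℝ) : Prop where
  radius_pos : 0 < R
  apply_eq_zero : u R = 0
  pos : ∀ t ∈ Ico 0 R, 0 < u t

lemma exists_isFirstZero {u : ℝ → ℝ} (hu : Continuous u) (hu0 : 0 < u 0)
    (hnonpos : ∃ r, 0 ≤ r ∧ u r ≤ 0) : ∃ R, IsFirstZero u R := by
  set A := {t | 0 ≤ t ∧ u t ≤ 0}
  have hA : IsClosed A :=
    (isClosed_le continuous_const continuous_id).inter (isClosed_le hu continuous_const)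
  have hbdd : BddBelow A := ⟨0, fun t ht => ht.1⟩
  have hmem : sInf A ∈ A := hA.csInf_mem hnonpos hbdd
  have hbefore : ∀ t ∈ Ico 0 (sInf A), 0 < u t := fun t ht => not_le.1 fun hut =>
    ht.2.not_ge (csInf_le hbdd ⟨ht.1, hut⟩)
  have hpos : 0 < sInf A := hmem.1.lt_of_ne fun h0 => hmem.2.not_gt (h0 ▸ hu0)
  refine ⟨sInf A, hpos, hmem.2.antisymm ?_, hbefore⟩
  have hIcc : Icc 0 (sInf A) ⊆ {t | 0 ≤ u t} := by
    rw [← closure_Ico hpos.ne]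
    exact closure_minimal (fun t ht => (hbefore t ht).le) (isClosed_le continuous_const hu)
  exact hIcc ⟨hpos.le, le_rfl⟩

lemma IsFirstZero.eq_of_eqOn {u v : ℝ → ℝ} {R S : ℝ} (hR : IsFirstZero u R)
    (hS : IsFirstZero v S) (huv : EqOn u v (Ici 0)) : R = S := by
  refine le_antisymm (not_lt.1 fun hlt => ?_) (not_lt.1 fun hlt => ?_)
  · exact (hR.pos S ⟨hS.radius_pos.le, hlt⟩).ne' ((huv hS.radius_pos.le).trans hS.apply_eq_zero)
  · exact (hS.pos R ⟨hR.radius_pos.le, hlt⟩).ne'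
      ((huv hR.radius_pos.le).symm.trans hR.apply_eq_zero)

/-- `R` is the first zero of the shot with initial value `a`. -/
def IsShotZero (n : ℕ) (m q : ℝ) (K : ℝ → ℝ) (a R : ℝ) : Prop :=
  ∃ u, IsShot n m q K a u ∧ IsFirstZero u R

section ZeroMap

variable {n : ℕ} {m q γ a R : ℝ} {K u : ℝ → ℝ}

namespace IsShot

lemma radialSlope_pos (hu : IsShot n m q K a u) (h : ShootingData n m q γ K)
    (hR : IsFirstZero u R) {r : ℝ} (hr : R ≤ r) : 0 < radialSlope n m q K u r := by
  have hR0 := hR.radius_pos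
  have hr0 : 0 < r := hR0.trans_le hr
  have hmem : R / 2 ∈ Ico 0 R := ⟨(half_pos hR0).le, half_lt_self hR0⟩
  have humid := hR.pos _ hmem
  have hK := h.pos 0
  have ha := hu.pos
  have hn := h.n_pos
  have hflux : 0 < radialFlux n q K u r := by
    refine lt_of_lt_of_le ?_ (h.monotoneOn_radialFlux hu.cont hmem.1 hr0.le (hmem.2.le.trans hr))
    exact mul_pos (by positivity) (lt_of_lt_of_le (by positivity) (hu.le_fluxAvg h hR.pos hmem))
  rw [h.radialSlope_eq u hr0]
  positivity

lemma neg_iff (hu : IsShot n m q K a u) (h : ShootingData n m q γ K) (hR : IsFirstZero u R)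
    {r : ℝ} (hr : 0 ≤ r) : u r < 0 ↔ R < r := by
  refine ⟨fun hur => not_le.1 fun hrR => ?_, fun hRr => ?_⟩
  · rcases hrR.eq_or_lt with rfl | hrR
    · exact hur.ne hR.apply_eq_zero
    · exact hur.not_gt (hR.pos r ⟨hr, hrR⟩)
  · have hanti : StrictAntiOn u (Ici R) :=
      strictAntiOn_of_deriv_neg (convex_Ici R) hu.cont.continuousOn fun x hx => by
        rw [interior_Ici] at hx
        rw [(hu.hasDerivAt h (hR.radius_pos.trans hx)).deriv]
        exact neg_lt_zero.2 (hu.radialSlope_pos h hR (le_of_lt hx))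
    exact (hanti self_mem_Ici hRr.le hRr).trans_eq hR.apply_eq_zero

lemma pos_iff (hu : IsShot n m q K a u) (h : ShootingData n m q γ K) (hR : IsFirstZero u R)
    {r : ℝ} (hr : 0 ≤ r) : 0 < u r ↔ r < R := by
  refine ⟨fun hur => not_le.1 fun hRr => ?_, fun hrR => hR.pos r ⟨hr, hrR⟩⟩
  rcases hRr.eq_or_lt with rfl | hRr
  · exact hur.ne' hR.apply_eq_zero
  · exact hur.not_gt ((hu.neg_iff h hR hr).2 hRr)

lemma eqOn_of_eq (hu : IsShot n m q K a u) (h : ShootingData n m q γ K) {w : ℝ → ℝ} {T : ℝ}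
    (hw : Continuous w)
    (hw_eq : ∀ r ∈ Icc 0 T, w r = a - ∫ x in (0 : ℝ)..r, radialSlope n m q K w x) :
    EqOn u w (Icc 0 T) := by
  obtain ⟨L, hL⟩ := h.exists_abs_sub_le_mul hu.pos.le T
  intro r hr
  have hle := hL a a u w le_rfl le_rfl hu.cont hw (fun r hr => hu.eq r hr.1) hw_eq r hr
  rw [sub_self, abs_zero, mul_zero] at hle
  exact sub_eq_zero.1 (abs_nonpos_iff.1 hle)

lemma eqOn (hu : IsShot n m q K a u) (h : ShootingData n m q γ K) {w : ℝ → ℝ}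
    (hw : IsShot n m q K a w) : EqOn u w (Ici 0) := fun _ hr =>
  hu.eqOn_of_eq h hw.cont (fun r hr => hw.eq r hr.1) ⟨hr, le_rfl⟩

end IsShot

lemma IsShotZero.unique {R' : ℝ} (hR : IsShotZero n m q K a R) (h : ShootingData n m q γ K)
    (hR' : IsShotZero n m q K a R') : R = R' := by
  obtain ⟨u, hu, hzero⟩ := hR
  obtain ⟨w, hw, hzero'⟩ := hR'
  exact hzero.eq_of_eqOn hzero' (hu.eqOn h hw)

namespace ShootingData

lemma exists_isShotZero (h : ShootingData n m q γ K)
    (hstrict : ∃ x y, 0 ≤ x ∧ x < y ∧ K x < K y) (ha : 0 < a) :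
    ∃ R, IsShotZero n m q K a R := by
  obtain ⟨u, hu⟩ := h.exists_isShot ha
  obtain ⟨R, hR⟩ := exists_isFirstZero hu.cont (hu.apply_zero.symm ▸ ha)
    (hu.exists_nonpos h hstrict)
  exact ⟨R, u, hu, hR⟩

lemma continuousAt_shot_apply (h : ShootingData n m q γ K) {w : ℝ → ℝ → ℝ}
    (hw : ∀ b, 0 < b → IsShot n m q K b (w b)) (ha : 0 < a) {r : ℝ} (hr : 0 ≤ r) :
    ContinuousAt (fun b => w b r) a := by
  obtain ⟨L, hL⟩ := h.exists_abs_sub_le_mul (Λ := 2 * a) (by linarith) r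
  refine continuousAt_of_locally_lipschitz ha L fun b hb => ?_
  obtain ⟨hlower, hupper⟩ := abs_lt.1 hb
  have hb0 : 0 < b := by linarith
  exact hL b a (w b) (w a) (by linarith) (by linarith) (hw b hb0).cont (hw a ha).cont
    (fun r hr => (hw b hb0).eq r hr.1) (fun r hr => (hw a ha).eq r hr.1) r ⟨hr, le_rfl⟩

lemma exists_zero_map (h : ShootingData n m q γ K)
    (hstrict : ∃ x y, 0 ≤ x ∧ x < y ∧ K x < K y) :
    ∃ ρ : ℝ → ℝ, (∀ a, 0 < a → IsShotZero n m q K a (ρ a)) ∧ ContinuousOn ρ (Ioi 0) := by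
  choose! ρ w hw hρ using fun a (ha : 0 < a) => h.exists_isShotZero hstrict ha
  refine ⟨ρ, fun a ha => ⟨w a, hw a ha, hρ a ha⟩, fun a ha => ContinuousAt.continuousWithinAt ?_⟩
  have hev : ∀ᶠ b in 𝓝 a, 0 < b := lt_mem_nhds ha
  exact continuousAt_of_sign_change (fun r hr => h.continuousAt_shot_apply hw ha hr)
    (hev.mono fun b hb => (hρ b hb).radius_pos.le)
    (hev.mono fun b hb r hr => (hw b hb).pos_iff h (hρ b hb) hr)
    (hev.mono fun b hb r hr => (hw b hb).neg_iff h (hρ b hb) hr)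

end ShootingData

end ZeroMap

/-! ### Calculus of radial functions and fields -/

section RadialCalculus

variable {E : Type*} [NormedAddCommGroup E] [InnerProductSpace ℝ E] {f G φ : ℝ → ℝ} {d : ℝ} {x : E}

lemma hasFDerivAt_norm (hx : x ≠ 0) :
    HasFDerivAt (fun y : E => ‖y‖) (‖x‖⁻¹ • innerSL ℝ x) x := by
  have hx' := norm_ne_zero_iff.2 hx
  have hsqrt := ((hasStrictFDerivAt_norm_sq x).hasFDerivAt).sqrt (pow_ne_zero 2 hx')
  simp only [Real.sqrt_sq (norm_nonneg _)] at hsqrt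
  refine hsqrt.congr_fderiv ?_
  rw [two_smul, ← two_smul ℝ, smul_smul]
  congr 1
  field_simp

lemma hasGradientAt_radial [CompleteSpace E] (hx : x ≠ 0) (hf : HasDerivAt f d ‖x‖) :
    HasGradientAt (fun y : E => f ‖y‖) ((d / ‖x‖) • x) x := by
  rw [hasGradientAt_iff_hasFDerivAt]
  refine (hf.comp_hasFDerivAt x (hasFDerivAt_norm hx)).congr_fderiv ?_
  rw [map_smulₛₗ, smul_smul, div_eq_mul_inv]
  rfl

lemma hasGradientAt_radial_zero [CompleteSpace E] (hφ : ContinuousAt φ 0) (hφ0 : φ 0 = 0)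
    (hf : ∀ r, 0 ≤ r → |f r - f 0| ≤ r * φ r) : HasGradientAt (fun y : E => f ‖y‖) 0 0 := by
  rw [hasGradientAt_iff_hasFDerivAt, hasFDerivAt_iff_isLittleO_nhds_zero]
  have hφ_norm : Tendsto (fun y : E => φ ‖y‖) (𝓝 0) (𝓝 0) := by
    rw [← hφ0]
    exact hφ.tendsto.comp tendsto_norm_zero
  have hsmall := (Asymptotics.isBigO_refl (fun y : E => ‖y‖) (𝓝 0)).mul_isLittleO
    ((Asymptotics.isLittleO_one_iff ℝ).2 hφ_norm)
  simp only [mul_one] at hsmall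
  refine Asymptotics.IsLittleO.of_norm_right (Asymptotics.IsBigO.trans_isLittleO
    (Asymptotics.IsBigO.of_bound 1 (Eventually.of_forall fun y => ?_)) hsmall)
  simp only [zero_add, norm_zero, map_zero, zero_apply, sub_zero, one_mul, Real.norm_eq_abs]
  exact (hf ‖y‖ (norm_nonneg _)).trans (le_abs_self _)

lemma hasFDerivAt_radial_field (hx : x ≠ 0) (hG : HasDerivAt G d ‖x‖) :
    HasFDerivAt (fun y : E => G ‖y‖ • y)
      (G ‖x‖ • ContinuousLinearMap.id ℝ E + (d • (‖x‖⁻¹ • innerSL ℝ x)).smulRight x) x :=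
  (hG.comp_hasFDerivAt x (hasFDerivAt_norm hx)).smul (hasFDerivAt_id x)

lemma hasFDerivAt_radial_field_zero (hG : ContinuousAt G 0) :
    HasFDerivAt (fun y : E => G ‖y‖ • y) (G 0 • ContinuousLinearMap.id ℝ E) 0 := by
  rw [hasFDerivAt_iff_isLittleO_nhds_zero]
  have hG_norm : Tendsto (fun y : E => G ‖y‖ - G 0) (𝓝 0) (𝓝 0) := by
    simpa using (hG.tendsto.comp tendsto_norm_zero).sub_const (G 0)
  simpa [sub_smul] using ((Asymptotics.isLittleO_one_iff ℝ).2 hG_norm).smul_isBigO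
    (Asymptotics.isBigO_refl (fun y : E => y) (𝓝 0))

end RadialCalculus

section RadialDivergence

variable {n : ℕ} {p d : ℝ} {G : ℝ → ℝ} {U : EuclideanSpace ℝ (Fin n) → ℝ}
  {x : EuclideanSpace ℝ (Fin n)}

lemma divergence_radial_field (hx : x ≠ 0) (hG : HasDerivAt G d ‖x‖) :
    divergence (fun y : EuclideanSpace ℝ (Fin n) => G ‖y‖ • y) x = n * G ‖x‖ + ‖x‖ * d := by
  have := norm_ne_zero_iff.2 hx
  have hpartial : ∀ i : Fin n, ((G ‖x‖ • ContinuousLinearMap.id ℝ (EuclideanSpace ℝ (Fin n)) +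
      (d • (‖x‖⁻¹ • innerSL ℝ x)).smulRight x) (EuclideanSpace.single i 1)) i
      = G ‖x‖ + d * ‖x‖⁻¹ * x i ^ 2 := fun i => by
    simp [EuclideanSpace.inner_single_right, sq, mul_assoc]
  rw [divergence, (hasFDerivAt_radial_field hx hG).fderiv]
  simp only [hpartial, Finset.sum_add_distrib, ← Finset.mul_sum,
    ← EuclideanSpace.real_norm_sq_eq, Finset.sum_const, Finset.card_univ, Fintype.card_fin,
    nsmul_eq_mul]
  field_simp

lemma divergence_radial_field_zero (hG : ContinuousAt G 0) :
    divergence (fun y : EuclideanSpace ℝ (Fin n) => G ‖y‖ • y) 0 = n * G 0 := by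
  rw [divergence, (hasFDerivAt_radial_field_zero hG).fderiv]
  simp

lemma pFlux_of_hasGradientAt_radial (hx : x ≠ 0) (hU : HasGradientAt U ((d / ‖x‖) • x) x) :
    pFlux p U x = (|d| ^ (p - 2) * d / ‖x‖) • x := by
  rw [pFlux, hU.gradient, norm_smul, norm_div, norm_norm,
    div_mul_cancel₀ _ (norm_ne_zero_iff.2 hx), Real.norm_eq_abs, smul_smul, mul_div_assoc]

end RadialDivergence

lemma rpow_abs_mul_eq_neg_iff {p m y z : ℝ} (hm : 0 < m) (hpm : m * (p - 1) = 1) (hy : 0 ≤ y) :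
    |z| ^ (p - 2) * z = -y ↔ z = -y ^ m := by
  have hexp : ∀ {b : ℝ}, 0 < b → b ^ (p - 1) = b ^ (p - 2) * b := fun hb => by
    rw [← Real.rpow_add_one hb.ne']
    congr 1
    ring
  constructor
  · intro hz
    rcases eq_or_ne z 0 with rfl | hz0
    · rw [mul_zero, zero_eq_neg] at hz
      rw [hz, Real.zero_rpow hm.ne', neg_zero]
    · have hz_pos := abs_pos.2 hz0
      have hz_neg : z < 0 := hz0.lt_of_le (not_lt.1 fun hz1 => by
        linarith [mul_pos (Real.rpow_pos_of_pos hz_pos (p - 2)) hz1])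
      have hy_eq : y = |z| ^ (p - 1) := by
        rw [hexp hz_pos, abs_of_neg hz_neg] at *
        linarith
      rw [hy_eq, ← Real.rpow_mul hz_pos.le, mul_comm, hpm, Real.rpow_one, abs_of_neg hz_neg,
        neg_neg]
  · rintro rfl
    rcases hy.eq_or_lt with rfl | hy
    · simp [Real.zero_rpow hm.ne']
    · have hpos := Real.rpow_pos_of_pos hy m
      rw [abs_neg, abs_of_pos hpos, mul_neg, ← hexp hpos, ← Real.rpow_mul hy.le, hpm,
        Real.rpow_one]

lemma mul_abs_rpow_sub_two {x q : ℝ} (hx : 0 < x) : x * |x| ^ (q - 2) = x ^ (q - 1) := by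
  rw [abs_of_pos hx, mul_comm, ← Real.rpow_add_one hx.ne']
  congr 1
  ring

/-! ### From shots to radial solutions -/

section ToRadialSolution

variable {n : ℕ} {p m q γ a : ℝ} {K u : ℝ → ℝ}

namespace IsShot

lemma hasGradientAt (hu : IsShot n m q K a u) (h : ShootingData n m q γ K)
    (x : EuclideanSpace ℝ (Fin n)) :
    HasGradientAt (fun y : EuclideanSpace ℝ (Fin n) => u ‖y‖)
      ((-radialSlope n m q K u ‖x‖ / ‖x‖) • x) x := by
  rcases eq_or_ne x 0 with rfl | hx
  · rw [smul_zero]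
    have hm := h.one_le_m
    have hcont : Continuous fun r => (r * (K r * a ^ (q - 1))) ^ m :=
      (continuous_id.mul (h.cont.mul continuous_const)).rpow_const fun _ => Or.inr (by linarith)
    refine hasGradientAt_radial_zero (φ := fun r => (r * (K r * a ^ (q - 1))) ^ m)
      hcont.continuousAt (by simp [Real.zero_rpow (show m ≠ 0 by linarith)]) fun r hr => ?_
    have hlower := hu.init_sub_le h hr
    have hupper := hu.le_init h hr
    rw [hu.apply_zero, abs_sub_comm, abs_of_nonneg (by linarith)]
    linarith
  · exact hasGradientAt_radial hx (hu.hasDerivAt h (norm_pos_iff.2 hx))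

lemma pFlux_eq (hu : IsShot n m q K a u) (h : ShootingData n m q γ K) (hpm : m * (p - 1) = 1) :
    pFlux p (fun y : EuclideanSpace ℝ (Fin n) => u ‖y‖) =
      fun x => (-fluxAvg n q K u ‖x‖) • x := by
  ext1 x
  rcases eq_or_ne x 0 with rfl | hx
  · simp [pFlux, (hu.hasGradientAt h 0).gradient]
  · have hx' := norm_pos_iff.2 hx
    rw [pFlux_of_hasGradientAt_radial hx (hu.hasGradientAt h x), radialSlope,
      (rpow_abs_mul_eq_neg_iff (by linarith [h.one_le_m]) hpm
        (mul_nonneg hx'.le (h.fluxAvg_nonneg u hx'.le))).2 rfl, ← mul_neg,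
      mul_div_cancel_left₀ _ hx'.ne']

lemma contDiff_radial (hu : IsShot n m q K a u) (h : ShootingData n m q γ K) :
    ContDiff ℝ 1 (fun y : EuclideanSpace ℝ (Fin n) => u ‖y‖) := by
  have hm := h.one_le_m
  have hfderiv : fderiv ℝ (fun y : EuclideanSpace ℝ (Fin n) => u ‖y‖) = fun x =>
      InnerProductSpace.toDual ℝ _ (-(‖x‖ ^ (m - 1) * fluxAvg n q K u ‖x‖ ^ m) • x) := by
    ext1 x
    rw [(hu.hasGradientAt h x).hasFDerivAt.fderiv]
    congr 1
    rcases eq_or_ne x 0 with rfl | hx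
    · simp only [smul_zero]
    · have hx' := norm_pos_iff.2 hx
      rw [radialSlope, Real.mul_rpow hx'.le (h.fluxAvg_nonneg u hx'.le),
        Real.rpow_sub_one hx'.ne']
      congr 1
      ring
  rw [contDiff_one_iff_fderiv, hfderiv]
  refine ⟨fun x => (hu.hasGradientAt h x).hasFDerivAt.differentiableAt,
    (InnerProductSpace.toDual ℝ (EuclideanSpace ℝ (Fin n))).continuous.comp ?_⟩
  have hpow : Continuous fun x : EuclideanSpace ℝ (Fin n) => ‖x‖ ^ (m - 1) :=
    continuous_norm.rpow_const fun _ => Or.inr (by linarith)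
  have hflux : Continuous fun x : EuclideanSpace ℝ (Fin n) => fluxAvg n q K u ‖x‖ ^ m :=
    ((h.continuous_fluxAvg hu.cont).comp continuous_norm).rpow_const
      fun _ => Or.inr (by linarith)
  fun_prop

lemma differentiable_pFlux (hu : IsShot n m q K a u) (h : ShootingData n m q γ K)
    (hpm : m * (p - 1) = 1) :
    Differentiable ℝ (pFlux p (fun y : EuclideanSpace ℝ (Fin n) => u ‖y‖)) := by
  rw [hu.pFlux_eq h hpm]
  intro x
  rcases eq_or_ne x 0 with rfl | hx
  · exact (hasFDerivAt_radial_field_zero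
      (h.continuous_fluxAvg hu.cont).neg.continuousAt).differentiableAt
  · exact (hasFDerivAt_radial_field hx
      (hu.hasDerivAt_fluxAvg h (norm_pos_iff.2 hx)).neg).differentiableAt

lemma pLaplacian_eq (hu : IsShot n m q K a u) (h : ShootingData n m q γ K)
    (hpm : m * (p - 1) = 1) (x : EuclideanSpace ℝ (Fin n)) :
    pLaplacian p (fun y : EuclideanSpace ℝ (Fin n) => u ‖y‖) x = -radialSource q K u ‖x‖ := by
  rw [pLaplacian, hu.pFlux_eq h hpm]
  rcases eq_or_ne x 0 with rfl | hx
  · have hn : (n : ℝ) ≠ 0 := Nat.cast_ne_zero.2 h.n_pos.ne'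
    rw [divergence_radial_field_zero (G := fun r => -fluxAvg n q K u r)
      (h.continuous_fluxAvg hu.cont).neg.continuousAt, norm_zero, fluxAvg,
      ballAvg_zero_right h.n_pos]
    field_simp
  · have hx' := norm_pos_iff.2 hx
    rw [divergence_radial_field (G := fun r => -fluxAvg n q K u r) hx
      (hu.hasDerivAt_fluxAvg h hx').neg]
    field_simp
    ring

end IsShot

lemma IsShotZero.exists_isRadialSolution {R : ℝ} {K₀ : ℝ → ℝ}
    (hz : IsShotZero n m q K a R) (h : ShootingData n m q γ K) (hpm : m * (p - 1) = 1)
    (hq : q = sobolevExponent n p) (hK : EqOn K₀ K (Ici 0)) :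
    ∃ U : EuclideanSpace ℝ (Fin n) → ℝ, IsRadialSolution n p K₀ R U ∧ U 0 = a := by
  obtain ⟨u, hu, hR⟩ := hz
  have hpos : ∀ x ∈ Metric.ball (0 : EuclideanSpace ℝ (Fin n)) R, 0 < u ‖x‖ := fun x hx =>
    hR.pos ‖x‖ ⟨norm_nonneg x, mem_ball_zero_iff.1 hx⟩
  refine ⟨fun x => u ‖x‖, ⟨fun x _ y _ hxy => congrArg u hxy,
    (hu.cont.comp continuous_norm).continuousOn, (hu.contDiff_radial h).contDiffOn,
    (hu.differentiable_pFlux h hpm).differentiableOn, fun x hx => ?_, hpos, fun x hx => ?_⟩, ?_⟩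
  · rw [hu.pLaplacian_eq h hpm, mul_abs_rpow_sub_two (hpos x hx), hK (norm_nonneg x), ← hq,
      radialSource, max_eq_left (hpos x hx).le, neg_add_cancel]
  · simp only [mem_sphere_zero_iff_norm.1 hx, hR.apply_eq_zero]
  · simp only [norm_zero, hu.apply_zero]

end ToRadialSolution

/-! ### From radial solutions to shots -/

lemma eqOn_of_hasDerivAt_eq {D : Set ℝ} (hD : Convex ℝ D) {f g f' : ℝ → ℝ} {x₀ : ℝ}
    (hf : ContinuousOn f D) (hg : ContinuousOn g D)
    (hf' : ∀ x ∈ interior D, HasDerivAt f (f' x) x) (hg' : ∀ x ∈ interior D, HasDerivAt g (f' x) x)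
    (hx₀ : x₀ ∈ D) (hfg : f x₀ = g x₀) : EqOn f g D := by
  have hderiv : ∀ x ∈ interior D, HasDerivWithinAt (fun x => f x - g x) 0 (interior D) x :=
    fun x hx => (((hf' x hx).sub (hg' x hx)).congr_deriv (sub_self _)).hasDerivWithinAt
  have hmono := monotoneOn_of_hasDerivWithinAt_nonneg hD (hf.sub hg) hderiv fun _ _ => le_rfl
  have hanti := antitoneOn_of_hasDerivWithinAt_nonpos hD (hf.sub hg) hderiv fun _ _ => le_rfl
  intro x hx
  have hconst : f x - g x = f x₀ - g x₀ := by
    rcases le_total x x₀ with h | h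
    · exact (hmono hx hx₀ h).antisymm (hanti hx hx₀ h)
    · exact (hanti hx₀ hx h).antisymm (hmono hx₀ hx h)
  linarith

section FromRadialSolution

variable {n : ℕ} {p m q γ R r : ℝ} {K K₀ w : ℝ → ℝ} {U : EuclideanSpace ℝ (Fin n) → ℝ}
  {e x : EuclideanSpace ℝ (Fin n)}

/-- The restriction of `U` to the line spanned by `e`, which is taken to be a unit vector. -/
def radialProfile (U : EuclideanSpace ℝ (Fin n) → ℝ) (e : EuclideanSpace ℝ (Fin n)) (r : ℝ) : ℝ :=
  U (r • e)

/-- The component along the unit vector `e` of the field `|∇U|^{p-2} ∇U` at `r e`. -/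
def profileFlux (p : ℝ) (U : EuclideanSpace ℝ (Fin n) → ℝ) (e : EuclideanSpace ℝ (Fin n))
    (r : ℝ) : ℝ :=
  inner ℝ e (pFlux p U (r • e))

lemma norm_smul_unit (he : ‖e‖ = 1) (hr : 0 ≤ r) : ‖r • e‖ = r := by
  rw [norm_smul_of_nonneg hr, he, mul_one]

lemma smul_unit_mem_ball (he : ‖e‖ = 1) (hr : r ∈ Ico 0 R) : r • e ∈ Metric.ball 0 R := by
  rw [mem_ball_zero_iff, norm_smul_unit he hr.1]
  exact hr.2

lemma smul_unit_mem_closedBall (he : ‖e‖ = 1) (hr : r ∈ Icc 0 R) :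
    r • e ∈ Metric.closedBall 0 R := by
  rw [mem_closedBall_zero_iff, norm_smul_unit he hr.1]
  exact hr.2

namespace IsRadialSolution

lemma eq_radialProfile (hU : IsRadialSolution n p K₀ R U) (he : ‖e‖ = 1)
    (hx : x ∈ Metric.closedBall 0 R) : U x = radialProfile U e ‖x‖ :=
  hU.radial x hx _
    (smul_unit_mem_closedBall he ⟨norm_nonneg x, mem_closedBall_zero_iff.1 hx⟩)
    (norm_smul_unit he (norm_nonneg x)).symm

lemma continuousOn_radialProfile (hU : IsRadialSolution n p K₀ R U) (he : ‖e‖ = 1) :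
    ContinuousOn (radialProfile U e) (Icc 0 R) :=
  hU.continuousOn.comp (by fun_prop) fun _ hr => smul_unit_mem_closedBall he hr

lemma radialProfile_pos (hU : IsRadialSolution n p K₀ R U) (he : ‖e‖ = 1) (hr : r ∈ Ico 0 R) :
    0 < radialProfile U e r := hU.pos _ (smul_unit_mem_ball he hr)

lemma differentiableAt_radialProfile (hU : IsRadialSolution n p K₀ R U) (he : ‖e‖ = 1)
    (hr : r ∈ Ico 0 R) : DifferentiableAt ℝ (radialProfile U e) r := by
  have hdiff : DifferentiableAt ℝ U (r • e) :=
    (hU.contDiffOn.differentiableOn one_ne_zero).differentiableAt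
      (Metric.isOpen_ball.mem_nhds (smul_unit_mem_ball he hr))
  exact hdiff.comp r (by fun_prop)

lemma differentiableAt_profileFlux (hU : IsRadialSolution n p K₀ R U) (he : ‖e‖ = 1)
    (hr : r ∈ Ico 0 R) : DifferentiableAt ℝ (profileFlux p U e) r := by
  have hdiff : DifferentiableAt ℝ (pFlux p U) (r • e) :=
    hU.differentiableOn_flux.differentiableAt
      (Metric.isOpen_ball.mem_nhds (smul_unit_mem_ball he hr))
  exact (differentiableAt_const e).inner ℝ
    (hdiff.comp (f := fun s : ℝ => s • e) r (by fun_prop))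

lemma pFlux_eq_deriv (hU : IsRadialSolution n p K₀ R U) (he : ‖e‖ = 1)
    (hx : x ∈ Metric.ball 0 R) (hx0 : x ≠ 0) :
    pFlux p U x = (|deriv (radialProfile U e) ‖x‖| ^ (p - 2) *
      deriv (radialProfile U e) ‖x‖ / ‖x‖) • x := by
  refine pFlux_of_hasGradientAt_radial hx0 ?_
  have hderiv := (hU.differentiableAt_radialProfile he
    ⟨norm_nonneg x, mem_ball_zero_iff.1 hx⟩).hasDerivAt
  rw [hasGradientAt_iff_hasFDerivAt]
  refine (hasGradientAt_radial hx0 hderiv).hasFDerivAt.congr_of_eventuallyEq ?_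
  filter_upwards [Metric.isOpen_ball.mem_nhds hx] with y hy
  exact hU.eq_radialProfile he (Metric.ball_subset_closedBall hy)

lemma profileFlux_eq (hU : IsRadialSolution n p K₀ R U) (he : ‖e‖ = 1) (hr : r ∈ Ioo 0 R) :
    profileFlux p U e r =
      |deriv (radialProfile U e) r| ^ (p - 2) * deriv (radialProfile U e) r := by
  have hne : r • e ≠ 0 := norm_pos_iff.1 (by rw [norm_smul_unit he hr.1.le]; exact hr.1)
  rw [profileFlux, hU.pFlux_eq_deriv he (smul_unit_mem_ball he ⟨hr.1.le, hr.2⟩) hne,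
    norm_smul_unit he hr.1.le, smul_smul, div_mul_cancel₀ _ hr.1.ne', inner_smul_right,
    real_inner_self_eq_norm_sq, he, one_pow, mul_one]

lemma pFlux_eq_profileFlux (hU : IsRadialSolution n p K₀ R U) (he : ‖e‖ = 1)
    (hx : x ∈ Metric.ball 0 R) (hx0 : x ≠ 0) :
    pFlux p U x = (profileFlux p U e ‖x‖ / ‖x‖) • x := by
  rw [hU.pFlux_eq_deriv he hx hx0,
    hU.profileFlux_eq he ⟨norm_pos_iff.2 hx0, mem_ball_zero_iff.1 hx⟩]

lemma pLaplacian_smul_unit (hU : IsRadialSolution n p K₀ R U) (he : ‖e‖ = 1)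
    (hr : r ∈ Ioo 0 R) :
    pLaplacian p U (r • e) =
      (n - 1) / r * profileFlux p U e r + deriv (profileFlux p U e) r := by
  obtain ⟨hr0, hrR⟩ := hr
  have hnorm := norm_smul_unit he hr0.le
  have hne : r • e ≠ 0 := norm_pos_iff.1 (hnorm.symm ▸ hr0)
  have hquot : HasDerivAt (fun s => profileFlux p U e s / s)
      ((deriv (profileFlux p U e) r * r - profileFlux p U e r * 1) / r ^ 2) ‖r • e‖ := by
    rw [hnorm]
    exact (hU.differentiableAt_profileFlux he ⟨hr0.le, hrR⟩).hasDerivAt.div (hasDerivAt_id r)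
      hr0.ne'
  have hflux : pFlux p U =ᶠ[𝓝 (r • e)] fun y => (profileFlux p U e ‖y‖ / ‖y‖) • y := by
    filter_upwards [Metric.isOpen_ball.mem_nhds (smul_unit_mem_ball he ⟨hr0.le, hrR⟩),
      isOpen_ne.mem_nhds hne] with y hy hy0
    exact hU.pFlux_eq_profileFlux he hy hy0
  have hdiv := divergence_radial_field hne hquot
  rw [divergence, ← hflux.fderiv_eq, ← divergence, hnorm] at hdiv
  rw [pLaplacian, hdiv]
  field_simp
  ring

lemma hasDerivAt_pow_mul_profileFlux (hU : IsRadialSolution n p K₀ R U) (he : ‖e‖ = 1)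
    (hn : 0 < n) (hr : r ∈ Ioo 0 R) :
    HasDerivAt (fun r => r ^ (n - 1) * profileFlux p U e r)
      (-(r ^ (n - 1) * (K₀ r * radialProfile U e r ^ (sobolevExponent n p - 1)))) r := by
  have hr0 := hr.1
  have hr' : r ∈ Ico 0 R := ⟨hr0.le, hr.2⟩
  have heq := hU.equation _ (smul_unit_mem_ball he hr')
  rw [mul_abs_rpow_sub_two (hU.pos _ (smul_unit_mem_ball he hr')), norm_smul_unit he hr0.le,
    hU.pLaplacian_smul_unit he hr] at heq
  have hpow : ((n - 1 : ℕ) : ℝ) * r ^ (n - 1 - 1) = r ^ (n - 1) * ((n - 1) / r) := by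
    obtain ⟨k, rfl⟩ : ∃ k, n = k + 1 := ⟨n - 1, by omega⟩
    rcases k with _ | k
    · simp
    · simp only [Nat.add_sub_cancel, pow_succ]
      push_cast
      field_simp
      ring
  refine ((hasDerivAt_pow (n - 1) r).mul
    (hU.differentiableAt_profileFlux he hr').hasDerivAt).congr_deriv ?_
  rw [hpow, radialProfile]
  linear_combination r ^ (n - 1) * heq

lemma pow_mul_fluxAvg_eq (hU : IsRadialSolution n p K₀ R U) (he : ‖e‖ = 1) (hR : 0 < R)
    (hn : 2 ≤ n) (h : ShootingData n m q γ K) (hq : q = sobolevExponent n p)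
    (hK : EqOn K₀ K (Ici 0)) (hw : Continuous w) (hwU : EqOn w (radialProfile U e) (Icc 0 R)) :
    EqOn (fun r => r ^ n * fluxAvg n q K w r) (fun r => -(r ^ (n - 1) * profileFlux p U e r))
      (Ico 0 R) := by
  refine eqOn_of_hasDerivAt_eq (convex_Ico 0 R) (x₀ := 0)
    (f' := fun r => r ^ (n - 1) * radialSource q K w r) ?_ ?_ (fun r _ => ?_) (fun r hr => ?_)
    ⟨le_rfl, hR⟩ ?_
  · exact ((continuous_pow n).mul (h.continuous_fluxAvg hw)).continuousOn
  · exact ((continuous_pow (n - 1)).continuousOn.mul fun r hr =>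
      (hU.differentiableAt_profileFlux he hr).continuousAt.continuousWithinAt).neg
  · exact hasDerivAt_pow_mul_ballAvg h.n_pos (h.continuous_radialSource hw) r
  · rw [interior_Ico] at hr
    refine (hU.hasDerivAt_pow_mul_profileFlux he h.n_pos hr).neg.congr_deriv ?_
    rw [neg_neg, radialSource, hwU ⟨hr.1.le, hr.2.le⟩, ← hK hr.1.le, ← hq,
      max_eq_left (hU.radialProfile_pos he ⟨hr.1.le, hr.2⟩).le]
  · simp [show n ≠ 0 by omega, show n - 1 ≠ 0 by omega]

lemma hasDerivAt_radialProfile (hU : IsRadialSolution n p K₀ R U) (he : ‖e‖ = 1)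
    (hn : 2 ≤ n) (h : ShootingData n m q γ K) (hpm : m * (p - 1) = 1)
    (hq : q = sobolevExponent n p) (hK : EqOn K₀ K (Ici 0)) (hw : Continuous w)
    (hwU : EqOn w (radialProfile U e) (Icc 0 R)) (hr : r ∈ Ioo 0 R) :
    HasDerivAt (radialProfile U e) (-radialSlope n m q K w r) r := by
  have hr0 := hr.1
  have hmul := hU.pow_mul_fluxAvg_eq he (hr0.trans hr.2) hn h hq hK hw hwU ⟨hr0.le, hr.2⟩
  have hflux : profileFlux p U e r = -(r * fluxAvg n q K w r) := by
    refine mul_left_cancel₀ (pow_pos hr0 (n - 1)).ne' ?_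
    rw [mul_neg, ← mul_assoc, ← pow_succ, Nat.sub_add_cancel h.n_pos]
    exact neg_eq_iff_eq_neg.1 hmul.symm
  rw [radialSlope, ← (rpow_abs_mul_eq_neg_iff (by linarith [h.one_le_m]) hpm
    (mul_nonneg hr0.le (h.fluxAvg_nonneg w hr0.le))).1 ((hU.profileFlux_eq he hr).symm.trans hflux)]
  exact (hU.differentiableAt_radialProfile he ⟨hr0.le, hr.2⟩).hasDerivAt

lemma eq_sub_integral_radialSlope (hU : IsRadialSolution n p K₀ R U) (he : ‖e‖ = 1)
    (hn : 2 ≤ n) (h : ShootingData n m q γ K) (hpm : m * (p - 1) = 1)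
    (hq : q = sobolevExponent n p) (hK : EqOn K₀ K (Ici 0)) (hw : Continuous w)
    (hwU : EqOn w (radialProfile U e) (Icc 0 R)) (hr : r ∈ Icc 0 R) :
    w r = U 0 - ∫ x in (0 : ℝ)..r, radialSlope n m q K w x := by
  have hint : ∀ s, HasDerivAt (fun r => U 0 - ∫ x in (0 : ℝ)..r, radialSlope n m q K w x)
      (-radialSlope n m q K w s) s := fun s =>
    ((h.continuous_radialSlope hw).integral_hasStrictDerivAt 0 s).hasDerivAt.const_sub (U 0)
  rw [hwU hr]
  refine eqOn_of_hasDerivAt_eq (convex_Icc 0 R) (x₀ := 0) (hU.continuousOn_radialProfile he)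
    (fun s _ => (hint s).continuousAt.continuousWithinAt) (fun s hs => ?_) (fun s _ => hint s)
    ⟨le_rfl, hr.1.trans hr.2⟩ (by simp [radialProfile]) hr
  rw [interior_Icc] at hs
  exact hU.hasDerivAt_radialProfile he hn h hpm hq hK hw hwU hs

lemma isShotZero (hU : IsRadialSolution n p K₀ R U) (hR : 0 < R) (hn : 2 ≤ n)
    (h : ShootingData n m q γ K) (hpm : m * (p - 1) = 1) (hq : q = sobolevExponent n p)
    (hK : EqOn K₀ K (Ici 0)) : IsShotZero n m q K (U 0) R := by
  obtain ⟨e, he⟩ : ∃ e : EuclideanSpace ℝ (Fin n), ‖e‖ = 1 :=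
    ⟨EuclideanSpace.single ⟨0, h.n_pos⟩ 1, by simp⟩
  have hcont := hU.continuousOn_radialProfile he
  set w := IccExtend hR.le ((Icc 0 R).domRestrict (radialProfile U e))
  have hw : Continuous w := hcont.domRestrict.Icc_extend'
  have hwU : EqOn w (radialProfile U e) (Icc 0 R) := fun r hr => IccExtend_of_mem _ _ hr
  obtain ⟨u, hu⟩ := h.exists_isShot (hU.pos 0 (Metric.mem_ball_self hR))
  have huU : EqOn u (radialProfile U e) (Icc 0 R) := (hu.eqOn_of_eq h hw fun r hr =>
    hU.eq_sub_integral_radialSlope he hn h hpm hq hK hw hwU hr).trans hwU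
  refine ⟨u, hu, hR, ?_, fun t ht => ?_⟩
  · rw [huU ⟨hR.le, le_rfl⟩]
    exact hU.boundary _ (mem_sphere_zero_iff_norm.2 (norm_smul_unit he hR.le))
  · rw [huU ⟨ht.1, ht.2.le⟩]
    exact hU.radialProfile_pos he ht

end IsRadialSolution

end FromRadialSolution

/-! ### The zero as a function of the logarithm of the initial value -/

/-- On every interval `(0, M]` one has `r K'(r) ≤ C r^l`, with a constant `C` depending on `M`. -/
def IsFlatOfOrder (K : ℝ → ℝ) (l : ℝ) : Prop :=
  ∀ M, 0 < M → ∃ C, 0 < C ∧ ∀ r ∈ Ioc 0 M, r * deriv K r ≤ C * r ^ l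

section LogZeroMap

variable {n : ℕ} {m q γ l M : ℝ} {K σ : ℝ → ℝ}

lemma IsShotZero.radius_pos {a R : ℝ} (hR : IsShotZero n m q K a R) : 0 < R := by
  obtain ⟨u, -, hzero⟩ := hR
  exact hzero.radius_pos

namespace ShootingData

lemma exists_log_zero_map (h : ShootingData n m q γ K)
    (hstrict : ∃ x y, 0 ≤ x ∧ x < y ∧ K x < K y) :
    ∃ σ : ℝ → ℝ, Continuous σ ∧ ∀ t, IsShotZero n m q K (Real.exp t) (σ t) := by
  obtain ⟨ρ, hρ, hcont⟩ := h.exists_zero_map hstrict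
  exact ⟨fun t => ρ (Real.exp t), hcont.comp_continuous Real.continuous_exp Real.exp_pos,
    fun t => hρ _ (Real.exp_pos t)⟩

lemma tendsto_log_zero_map_atBot (h : ShootingData n m q γ K)
    (hσ : ∀ t, IsShotZero n m q K (Real.exp t) (σ t)) : Tendsto σ atBot atTop := by
  have hm := h.one_le_m
  have hγ := h.γ_pos
  refine tendsto_atTop.2 fun M => ?_
  have hlim : Tendsto (fun t : ℝ => M ^ (1 + m) * K M ^ m * Real.exp t ^ (γ * (1 + m))) atBot
      (𝓝 (M ^ (1 + m) * K M ^ m * 0 ^ (γ * (1 + m)))) :=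
    (Real.tendsto_exp_atBot.rpow_const (Or.inr (by positivity))).const_mul _
  rw [Real.zero_rpow (by positivity), mul_zero] at hlim
  filter_upwards [hlim.eventually (gt_mem_nhds one_pos)] with t ht
  refine not_lt.1 fun hlt => ht.not_ge ?_
  obtain ⟨u, hu, hR⟩ := hσ t
  have hR0 := hR.radius_pos.le
  have hK := h.pos M
  calc 1 ≤ σ t ^ (1 + m) * K M ^ m * Real.exp t ^ (γ * (1 + m)) :=
        hu.one_le_of_apply_eq_zero h hR0 hlt.le hR.apply_eq_zero
    _ ≤ M ^ (1 + m) * K M ^ m * Real.exp t ^ (γ * (1 + m)) := by gcongr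

lemma exists_log_zero_map_ge (h : ShootingData n m q γ K) (hl : 0 < l) (hln : l < n * m)
    (hK : IsFlatOfOrder K l) (hσ : ∀ t, IsShotZero n m q K (Real.exp t) (σ t)) (hM : 0 < M) :
    ∃ c : ℝ, 0 < c ∧ ∀ t, σ t ≤ M →
      c * Real.exp t ^ (γ * l - (1 + m)) ≤ σ t ^ ((1 + m) / γ) := by
  obtain ⟨C, hC, hKC⟩ := hK M hM
  obtain ⟨c, hc, hle⟩ := h.exists_mul_rpow_le_rpow hl hln hC hKC
  refine ⟨c, hc, fun t ht => ?_⟩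
  obtain ⟨u, hu, hR⟩ := hσ t
  exact hle _ _ u hu hR.radius_pos ht hR.apply_eq_zero hR.pos

lemma exists_pos_forall_le_log_zero_map (h : ShootingData n m q γ K)
    (hK : IsFlatOfOrder K ((1 + m) / γ)) (hσ : ∀ t, IsShotZero n m q K (Real.exp t) (σ t)) :
    ∃ c : ℝ, 0 < c ∧ ∀ t, c ≤ σ t := by
  have hl := h.criticalRate_pos
  obtain ⟨c, hc, hle⟩ := h.exists_log_zero_map_ge hl (by rw [h.n_mul_m]; linarith [h.one_le_m])
    hK hσ one_pos
  refine ⟨min 1 (c ^ ((1 + m) / γ)⁻¹), by positivity, fun t => ?_⟩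
  rcases le_total (σ t) 1 with hσt | hσt
  · have hct := hle t hσt
    rw [mul_div_cancel₀ _ h.γ_pos.ne', sub_self, Real.rpow_zero, mul_one] at hct
    exact (min_le_right _ _).trans
      ((Real.rpow_inv_le_iff_of_pos hc.le (hσ t).radius_pos.le hl).2 hct)
  · exact (min_le_left _ _).trans hσt

lemma tendsto_log_zero_map_atTop (h : ShootingData n m q γ K) (hl : (1 + m) / γ < l)
    (hln : l < n * m) (hK : IsFlatOfOrder K l)
    (hσ : ∀ t, IsShotZero n m q K (Real.exp t) (σ t)) : Tendsto σ atTop atTop := by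
  have hcrit := h.criticalRate_pos
  refine tendsto_atTop.2 fun M => ?_
  rcases le_or_gt M 0 with hM | hM
  · exact Eventually.of_forall fun t => hM.trans (hσ t).radius_pos.le
  obtain ⟨c, hc, hle⟩ := h.exists_log_zero_map_ge (hcrit.trans hl) hln hK hσ hM
  have hexp : 0 < γ * l - (1 + m) := by
    rw [div_lt_iff₀ h.γ_pos] at hl
    linarith
  have hlim : Tendsto (fun t : ℝ => c * Real.exp t ^ (γ * l - (1 + m))) atTop atTop :=
    ((tendsto_rpow_atTop hexp).comp Real.tendsto_exp_atTop).const_mul_atTop hc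
  filter_upwards [hlim.eventually (eventually_gt_atTop (M ^ ((1 + m) / γ)))] with t ht
  refine not_lt.1 fun hlt => ht.not_ge ((hle t hlt.le).trans ?_)
  exact Real.rpow_le_rpow (hσ t).radius_pos.le hlt.le hcrit.le

end ShootingData

end LogZeroMap

/-! ### Flatness of the weight -/

section Flatness

variable {K K₀ : ℝ → ℝ} {l l' : ℝ}

lemma IsFlatOfOrder.mono (hK : IsFlatOfOrder K l) (hl : l' ≤ l) : IsFlatOfOrder K l' := by
  intro M hM
  obtain ⟨C, hC, hle⟩ := hK M hM
  refine ⟨C * M ^ (l - l'), by positivity, fun r hr => (hle r hr).trans ?_⟩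
  have hr0 := hr.1
  calc C * r ^ l = C * r ^ (l - l') * r ^ l' := by
        rw [mul_assoc, ← Real.rpow_add hr0, sub_add_cancel]
    _ ≤ C * M ^ (l - l') * r ^ l' := by
        gcongr
        exact hr.2

lemma IsFlatOfOrder.congr (hK : IsFlatOfOrder K l) (hKK₀ : EqOn K₀ K (Ioi 0)) :
    IsFlatOfOrder K₀ l := by
  intro M hM
  obtain ⟨C, hC, hle⟩ := hK M hM
  refine ⟨C, hC, fun r hr => ?_⟩
  rw [(hKK₀.eventuallyEq_of_mem (Ioi_mem_nhds hr.1)).deriv_eq]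
  exact hle r hr

lemma isFlatOfOrder_of_isBigO (hK : ContDiffOn ℝ 1 K (Ici 0))
    (hO : deriv K =O[𝓝[>] 0] fun r => r ^ (l - 1)) : IsFlatOfOrder K l := by
  intro M _
  obtain ⟨c, hc, hbound⟩ := hO.exists_pos
  obtain ⟨δ, hδ, hnear⟩ := mem_nhdsGT_iff_exists_Ioo_subset.1 hbound.bound
  have hcont : ContinuousOn (fun r => deriv K r / r ^ (l - 1)) (Icc δ M) := by
    have hpos : ∀ r ∈ Icc δ M, 0 < r := fun r hr => lt_of_lt_of_le hδ hr.1
    have hderiv := (hK.mono Ioi_subset_Ici_self).continuousOn_deriv_of_isOpen isOpen_Ioi le_rfl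
    exact (hderiv.mono hpos).div
      (continuousOn_id.rpow_const fun r hr => Or.inl (hpos r hr).ne')
      fun r hr => (Real.rpow_pos_of_pos (hpos r hr) _).ne'
  obtain ⟨C, hC⟩ := isCompact_Icc.bddAbove_image hcont
  refine ⟨max c C, lt_max_of_lt_left hc, fun r hr => ?_⟩
  have hr0 := hr.1
  have hpow : 0 < r ^ (l - 1) := Real.rpow_pos_of_pos hr0 _
  have hle : deriv K r ≤ max c C * r ^ (l - 1) := by
    rcases lt_or_ge r δ with hrδ | hrδ
    · have hnorm : ‖deriv K r‖ ≤ c * ‖r ^ (l - 1)‖ := hnear ⟨hr0, hrδ⟩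
      rw [Real.norm_of_nonneg hpow.le] at hnorm
      exact (le_abs_self _).trans (hnorm.trans (by gcongr; exact le_max_left _ _))
    · rw [← div_le_iff₀ hpow]
      exact (hC ⟨r, ⟨hrδ, hr.2⟩, rfl⟩).trans (le_max_right _ _)
  calc r * deriv K r ≤ r * (max c C * r ^ (l - 1)) := by gcongr
    _ = max c C * r ^ l := by rw [mul_left_comm, mul_rpow_sub_one_eq hr0]

lemma differentiableAt_of_contDiffOn_Ici (hK : ContDiffOn ℝ 1 K (Ici 0)) {r : ℝ} (hr : 0 < r) :
    DifferentiableAt ℝ K r :=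
  (hK.differentiableOn one_ne_zero).differentiableAt (Ici_mem_nhds hr)

lemma FlatnessCondition.isBigO_deriv (hl : FlatnessCondition K l)
    (hK : ContDiffOn ℝ 1 K (Ici 0)) : deriv K =O[𝓝[>] 0] fun r => r ^ (l - 1) := by
  obtain ⟨hl0, A, B, -, hB, f, hf, hlim⟩ := hl
  refine Asymptotics.IsBigO.of_bound (B * l + 1) ?_
  filter_upwards [hlim.eventually (gt_mem_nhds one_pos), self_mem_nhdsWithin] with r hr hr0
  replace hr0 : 0 < r := hr0
  have hpow : 0 < r ^ (l - 1) := Real.rpow_pos_of_pos hr0 _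
  have hderiv : deriv f r = deriv K r - B * (l * r ^ (l - 1)) := by
    refine HasDerivAt.deriv ?_
    refine (((differentiableAt_of_contDiffOn_Ici hK hr0).hasDerivAt.sub
      ((Real.hasDerivAt_rpow_const (Or.inl hr0.ne')).const_mul B)).sub_const A)
      |>.congr_of_eventuallyEq ?_
    filter_upwards [Ioi_mem_nhds hr0] with x hx
    simp only [Pi.sub_apply]
    linarith [hf x (le_of_lt hx)]
  have hf' : |deriv f r| ≤ r ^ (l - 1) := by
    rw [div_lt_one (Real.rpow_pos_of_pos hr0 l), ← mul_rpow_sub_one_eq hr0 l] at hr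
    exact le_of_mul_le_mul_left (by linarith [abs_nonneg (f r)]) hr0
  rw [Real.norm_of_nonneg hpow.le, Real.norm_eq_abs,
    show deriv K r = B * l * r ^ (l - 1) + deriv f r by rw [hderiv]; ring]
  calc |B * l * r ^ (l - 1) + deriv f r| ≤ |B * l * r ^ (l - 1)| + |deriv f r| := abs_add_le _ _
    _ ≤ B * l * r ^ (l - 1) + r ^ (l - 1) := by
        rw [abs_of_nonneg (by positivity)]
        gcongr
    _ = (B * l + 1) * r ^ (l - 1) := by ring

end Flatness

/-! ### The radii of solvability -/

/-- `σ t` is the radius of the ball on which the radial solution with value `exp t` at the origin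
lives, and these are all the radii for which the problem is solvable. The logarithmic parameter
makes `σ` a function on the whole line. -/
structure IsRadiusMap (n : ℕ) (p : ℝ) (K σ : ℝ → ℝ) : Prop where
  continuous : Continuous σ
  pos : ∀ t, 0 < σ t
  exists_isRadialSolution : ∀ t, ∃ u : EuclideanSpace ℝ (Fin n) → ℝ,
    IsRadialSolution n p K (σ t) u ∧ u 0 = Real.exp t
  mem_range : ∀ R, 0 < R → (∃ u, IsRadialSolution n p K R u) → R ∈ range σ
  tendsto_atBot : Tendsto σ atBot atTop

lemma exists_lt_eq_of_tendsto_atBot {σ : ℝ → ℝ} (hσ : Continuous σ) (hbot : Tendsto σ atBot atTop)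
    {t₀ R : ℝ} (hR : σ t₀ < R) : ∃ t < t₀, σ t = R := by
  obtain ⟨s, hRs, hst⟩ := ((hbot.eventually (eventually_ge_atTop R)).and
    (eventually_le_atBot t₀)).exists
  obtain ⟨t, ht, rfl⟩ := intermediate_value_Icc' hst hσ.continuousOn ⟨hR.le, hRs⟩
  exact ⟨t, ht.2.lt_of_ne fun h => hR.ne (congrArg σ h).symm, rfl⟩

lemma exists_ge_eq_of_tendsto_atTop {σ : ℝ → ℝ} (hσ : Continuous σ) (htop : Tendsto σ atTop atTop)
    {t₀ R : ℝ} (hR : σ t₀ ≤ R) : ∃ t ≥ t₀, σ t = R := by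
  obtain ⟨s, hRs, hts⟩ := ((htop.eventually (eventually_ge_atTop R)).and
    (eventually_ge_atTop t₀)).exists
  obtain ⟨t, ht, hσt⟩ := intermediate_value_Icc hts hσ.continuousOn ⟨hR, hRs⟩
  exact ⟨t, ht.1, hσt⟩

namespace IsRadiusMap

variable {n : ℕ} {p : ℝ} {K σ : ℝ → ℝ}

lemma exists_isRadialSolution_iff_mem_range (hσ : IsRadiusMap n p K σ) {R : ℝ} (hR : 0 < R) :
    (∃ u, IsRadialSolution n p K R u) ↔ R ∈ range σ := by
  refine ⟨hσ.mem_range R hR, ?_⟩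
  rintro ⟨t, rfl⟩
  obtain ⟨u, hu, -⟩ := hσ.exists_isRadialSolution t
  exact ⟨u, hu⟩

lemma exists_threshold (hσ : IsRadiusMap n p K σ) (hbelow : ∃ c, 0 < c ∧ ∀ t, c ≤ σ t) :
    ∃ R₀ : ℝ, 0 < R₀ ∧
      (∀ R, 0 < R → R < R₀ → ¬ ∃ u, IsRadialSolution n p K R u) ∧
      (∀ R, R₀ < R → ∃ u, IsRadialSolution n p K R u) := by
  obtain ⟨c, hc, hcσ⟩ := hbelow
  have hlower : c ∈ lowerBounds (range σ) := forall_mem_range.2 hcσ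
  have hpos : 0 < sInf (range σ) := hc.trans_le (le_csInf (range_nonempty σ) hlower)
  refine ⟨sInf (range σ), hpos, fun R hR hlt hex => ?_, fun R hR => ?_⟩
  · exact hlt.not_ge (csInf_le ⟨c, hlower⟩ (hσ.mem_range R hR hex))
  · obtain ⟨_, ⟨t₀, rfl⟩, ht₀⟩ := exists_lt_of_csInf_lt (range_nonempty σ) hR
    obtain ⟨t, -, ht⟩ := exists_lt_eq_of_tendsto_atBot hσ.continuous hσ.tendsto_atBot ht₀
    exact (hσ.exists_isRadialSolution_iff_mem_range (hpos.trans hR)).2 ⟨t, ht⟩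

lemma exists_threshold_of_tendsto_atTop (hσ : IsRadiusMap n p K σ)
    (htop : Tendsto σ atTop atTop) :
    ∃ R₀ : ℝ, 0 < R₀ ∧
      (∀ R, 0 < R → R < R₀ → ¬ ∃ u, IsRadialSolution n p K R u) ∧
      (∃ u, IsRadialSolution n p K R₀ u) ∧
      (∀ R, R₀ < R → ∃ u₁ u₂, IsRadialSolution n p K R u₁ ∧ IsRadialSolution n p K R u₂ ∧
        ∃ x ∈ Metric.closedBall (0 : EuclideanSpace ℝ (Fin n)) R, u₁ x ≠ u₂ x) := by
  obtain ⟨t₀, hmin⟩ : ∃ t₀, ∀ t, σ t₀ ≤ σ t := hσ.continuous.exists_forall_le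
    (cocompact_eq_atBot_atTop (α := ℝ) ▸ hσ.tendsto_atBot.sup htop)
  have hpos := hσ.pos t₀
  refine ⟨σ t₀, hpos, fun R hR hlt hex => ?_,
    (hσ.exists_isRadialSolution_iff_mem_range hpos).2 ⟨t₀, rfl⟩, fun R hR => ?_⟩
  · obtain ⟨t, rfl⟩ := hσ.mem_range R hR hex
    exact hlt.not_ge (hmin t)
  · obtain ⟨t₁, ht₁, rfl⟩ := exists_lt_eq_of_tendsto_atBot hσ.continuous hσ.tendsto_atBot hR
    obtain ⟨t₂, ht₂, heq⟩ := exists_ge_eq_of_tendsto_atTop hσ.continuous htop hR.le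
    obtain ⟨u₁, hu₁, hu₁0⟩ := hσ.exists_isRadialSolution t₁
    obtain ⟨u₂, hu₂, hu₂0⟩ := hσ.exists_isRadialSolution t₂
    refine ⟨u₁, u₂, hu₁, heq ▸ hu₂, 0, Metric.mem_closedBall_self (hσ.pos t₁).le, ?_⟩
    rw [hu₁0, hu₂0]
    exact (Real.exp_lt_exp.2 (ht₁.trans_le ht₂)).ne

end IsRadiusMap

lemma ShootingData.isRadiusMap {n : ℕ} {p m q γ : ℝ} {K K₀ σ : ℝ → ℝ}
    (h : ShootingData n m q γ K) (hn : 2 ≤ n) (hpm : m * (p - 1) = 1)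
    (hq : q = sobolevExponent n p) (hK : EqOn K₀ K (Ici 0)) (hcont : Continuous σ)
    (hσ : ∀ t, IsShotZero n m q K (Real.exp t) (σ t)) : IsRadiusMap n p K₀ σ where
  continuous := hcont
  pos t := (hσ t).radius_pos
  exists_isRadialSolution t := (hσ t).exists_isRadialSolution h hpm hq hK
  mem_range := by
    rintro R hR ⟨u, hu⟩
    have hu0 : 0 < u 0 := hu.pos 0 (Metric.mem_ball_self hR)
    refine ⟨Real.log (u 0), (hσ _).unique h ?_⟩
    rw [Real.exp_log hu0]
    exact hu.isShotZero hR hn h hpm hq hK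
  tendsto_atBot := h.tendsto_log_zero_map_atBot hσ

lemma shootingData_of_monotoneOn {n : ℕ} {p : ℝ} {K : ℝ → ℝ} (hp1 : 1 < p) (hpn : p < n)
    (hp_lower : 2 * (n : ℝ) / (2 + n) ≤ p) (hp_upper : p ≤ 2) (hK_pos : ∀ r, 0 ≤ r → 0 < K r)
    (hK_smooth : ContDiffOn ℝ 1 K (Ici 0)) (hK_mono : MonotoneOn K (Ici 0)) :
    ShootingData n (p - 1)⁻¹ (sobolevExponent n p) (p / (n - p)) fun r => K (max r 0) := by
  have hn : (0 : ℝ) < n := by linarith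
  have hnp : 0 < (n : ℝ) - p := by linarith
  have hp : 0 < p - 1 := by linarith
  have hmem : ∀ r : ℝ, max r 0 ∈ Ici 0 := fun r => le_max_right r 0
  refine ⟨Nat.cast_pos.1 hn, (one_le_inv₀ hp).2 (by linarith), ?_, by positivity, ?_, ?_,
    hK_smooth.continuousOn.comp_continuous (by fun_prop) hmem, fun r => hK_pos _ (hmem r),
    fun x y hxy => hK_mono (hmem x) (hmem y) (max_le_max_right 0 hxy), fun r hr => ?_⟩
  · rw [div_le_iff₀ (by linarith)] at hp_lower
    rw [sobolevExponent, le_div_iff₀ hnp]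
    linarith
  · rw [sobolevExponent, mul_div_assoc]
  · rw [sobolevExponent]
    field_simp
    ring
  · refine (differentiableAt_of_contDiffOn_Ici hK_smooth hr).congr_of_eventuallyEq ?_
    filter_upwards [Ioi_mem_nhds hr] with x hx
    rw [max_eq_left (le_of_lt hx)]

lemma criticalFlatness_eq {n : ℕ} {p : ℝ} (hp1 : 1 < p) (hpn : p < n) :
    criticalFlatness n p = (1 + (p - 1)⁻¹) / (p / (n - p)) := by
  have hnp : (n : ℝ) - p ≠ 0 := by linarith
  have hp : p - 1 ≠ 0 := by linarith
  rw [criticalFlatness]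
  field_simp
  ring

theorem theorem2_general (n : ℕ) (p : ℝ) (hp1 : 1 < p) (hpn : p < n)
    (hp_lower : 2 * (n : ℝ) / (2 + n) ≤ p) (hp_upper : p ≤ 2)
    (K : ℝ → ℝ) (hK_pos : ∀ r, 0 ≤ r → 0 < K r) (hK_smooth : ContDiffOn ℝ 1 K (Ici 0))
    (l : ℝ) (hK_deriv : deriv K =O[𝓝[>] 0] fun r => r ^ (l - 1))
    (hK_incr : IncreasingCondition K) :
    (l = criticalFlatness n p →
      ∃ R₀ : ℝ, 0 < R₀ ∧
        (∀ R, 0 < R → R < R₀ → ¬ ∃ u, IsRadialSolution n p K R u) ∧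
        (∀ R, R₀ < R → ∃ u, IsRadialSolution n p K R u)) ∧
    (criticalFlatness n p < l →
      ∃ R₀ : ℝ, 0 < R₀ ∧
        (∀ R, 0 < R → R < R₀ → ¬ ∃ u, IsRadialSolution n p K R u) ∧
        (∃ u, IsRadialSolution n p K R₀ u) ∧
        (∀ R, R₀ < R → ∃ u₁ u₂, IsRadialSolution n p K R u₁ ∧ IsRadialSolution n p K R u₂ ∧
          ∃ x ∈ Metric.closedBall (0 : EuclideanSpace ℝ (Fin n)) R, u₁ x ≠ u₂ x)) := by
  obtain ⟨hmono, x, y, hx, hxy, hstrict⟩ := hK_incr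
  have h := shootingData_of_monotoneOn hp1 hpn hp_lower hp_upper hK_pos hK_smooth hmono
  have hn : 2 ≤ n := Nat.one_lt_cast.1 (hp1.trans hpn)
  have hKext : EqOn K (fun r => K (max r 0)) (Ici 0) :=
    fun r hr => congrArg K (max_eq_left hr).symm
  have hflat := (isFlatOfOrder_of_isBigO hK_smooth hK_deriv).congr
    (hKext.symm.mono Ioi_subset_Ici_self)
  have hKxy : K x < K y := hstrict ⟨le_rfl, hxy.le⟩ ⟨hxy.le, le_rfl⟩ hxy
  rw [hKext hx, hKext (hx.trans hxy.le)] at hKxy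
  obtain ⟨σ, hcont, hσ⟩ := h.exists_log_zero_map ⟨x, y, hx, hxy, hKxy⟩
  have hmap := h.isRadiusMap hn (inv_mul_cancel₀ (by linarith)) rfl hKext hcont hσ
  rw [criticalFlatness_eq hp1 hpn]
  refine ⟨fun hl => hmap.exists_threshold ?_, fun hl =>
    hmap.exists_threshold_of_tendsto_atTop ?_⟩
  · exact h.exists_pos_forall_le_log_zero_map (hl ▸ hflat) hσ
  -- The decay estimate needs an order below `n / (p - 1)`, so the flatness is lowered if necessary.
  · obtain ⟨l', hcl', hl'⟩ := exists_between
      (lt_min hl (h.n_mul_m ▸ lt_add_of_pos_right _ (by linarith [h.one_le_m])))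
    exact h.tendsto_log_zero_map_atTop hcl' (hl'.trans_le (min_le_right _ _))
      (hflat.mono (hl'.le.trans (min_le_left _ _))) hσ

end

theorem theorem2 (n : ℕ) (p : ℝ) (hp1 : 1 < p) (hpn : p < n)
    (hp_lower : 2 * (n : ℝ) / (2 + n) ≤ p) (hp_upper : p ≤ 2)
    (K : ℝ → ℝ) (hK_pos : ∀ r, 0 ≤ r → 0 < K r) (hK_smooth : ContDiffOn ℝ 1 K (Set.Ici 0))
    (l : ℝ) (hl : FlatnessCondition K l) (hK_incr : IncreasingCondition K) :
    (l = criticalFlatness n p →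
      ∃ R₀ : ℝ, 0 < R₀ ∧
        (∀ R, 0 < R → R < R₀ → ¬ ∃ u, IsRadialSolution n p K R u) ∧
        (∀ R, R₀ < R → ∃ u, IsRadialSolution n p K R u)) ∧
    (criticalFlatness n p < l →
      ∃ R₀ : ℝ, 0 < R₀ ∧
        (∀ R, 0 < R → R < R₀ → ¬ ∃ u, IsRadialSolution n p K R u) ∧
        (∃ u, IsRadialSolution n p K R₀ u) ∧
        (∀ R, R₀ < R → ∃ u₁ u₂, IsRadialSolution n p K R u₁ ∧ IsRadialSolution n p K R u₂ ∧
          ∃ x ∈ Metric.closedBall (0 : EuclideanSpace ℝ (Fin n)) R, u₁ x ≠ u₂ x)) := by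
  exact theorem2_general n p hp1 hpn hp_lower hp_upper K hK_pos hK_smooth l
    (hl.isBigO_deriv hK_smooth) hK_incr
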